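/- **Setup.** Let $(M,d_M)$ be a Riemannian manifold (only the structure of a Polish metric space with its Borel $\sigma$-algebra is used) and let $f:M\to M$ be a Borel measurable map (for instance a diffeomorphism, possibly with singularities). Let $Y\subset M$ be a measurable subset with a countable measurable partition $\{Y_j\}$, and let $r:Y\to\mathbb Z^+$ be constant on each $Y_j$ with $f^{r(y)}(y)\in Y$ for all $y\in Y$. Put $F(y)=f^{r(y)}(y)$, $F:Y\to Y$. The separation time $s(y,y')$ is the least $n\ge 0$ such that $F^ny,F^ny'$ lie in distinct partition elements. Let $\mathcal W^s$ be a measurable partition of $Y$ into "stable leaves" (the leaves are separated by countably many measurable unions of leaves) such that each $Y_j$ is a union of leaves; $W^s(y)$ denotes the leaf containing $y$. Let $W^u\subset Y$ be a measurable set that meets each leaf in exactly one point. Let $\mu_Y$ be an $F$-invariant ergodic probability measure on $Y$. Let $\bar Y=Y/\mathcal W^s$ be the quotient with the quotient $\sigma$-algebra, $\pi:Y\to\bar Y$ the projection, and $\bar\mu_Y=\pi_*\mu_Y$. Assume: * (A1) $F(W^s(y))\subset W^s(Fy)$ for all $y\in Y$. Hence there is a quotient map $\bar F:\bar Y\to\bar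 Y$ with $\bar F\circ\pi=\pi\circ F$. * (A2) There are constants $C\ge1$, $\gamma_0\in(0,1)$ such that for all $j\ge0$ and $0\le\ell\le r(F^jy)$: (i) $d_M(f^\ell F^jy,f^\ell F^jy')\le C\gamma_0^{\,j}$ for all $y\in Y$, $y'\in W^s(y)$; (ii) $d_M(f^\ell F^jy,f^\ell F^jy')\le C\gamma_0^{\,s(y,y')-j}$ for all $y,y'\in W^u$ with $s(y,y')<\infty$. * (A3) $\bar F$ is a mixing Gibbs–Markov map on $(\bar Y,\bar\mu_Y)$ with partition $\alpha=\{\pi(Y_j)\}$. That is: $\bar F$ is ergodic and preserves $\bar\mu_Y$; $\bar\mu_Y(A\cap\bar F^{-n}B)\to\bar\mu_Y(A)\bar\mu_Y(B)$ for all measurable $A,B$; $\bar F$ maps each $a\in\alpha$ bijectively onto a union of elements of $\alpha$; any two distinct points of $\bar Y$ have finite separation time $s$ (with respect to $\bar F$ and $\alpha$); for some $\theta\in(0,1)$ and $K$ the density $g=d\bar\mu_Y/d(\bar\mu_Y\circ\bar F)$ has a positive version with $|\log g(y)-\log g(y')|\le K\theta^{s(y,y')}$ for all $y\ne y'$ in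 the same $a\in\alpha$; and $\inf_{a\in\alpha}\bar\mu_Y(\bar Fa)>0$. * (A4) $r\in L^1(Y,\mu_Y)$. Let $\mu_\Delta$ be the restriction of $\mu_Y\times\{\text{counting}\}$ to $\Delta=\{(y,\ell):0\le\ell<r(y)\}$, divided by $\int r\,d\mu_Y$, and let $\mu_M$ be the push-forward of $\mu_\Delta$ to $M$ under $(y,\ell)\mapsto f^\ell y$. Let $v:M\to\mathbb R^d$ be a bounded Hölder function (with some exponent $\eta\in(0,1]$) with $\int v\,d\mu_M=0$, and let $V(y)=\sum_{\ell=0}^{r(y)-1}v(f^\ell y)$ be the induced observable on $Y$. Let $L$ be the transfer operator of $\bar F$, given by $\int L\phi\,\psi\,d\bar\mu_Y=\int\phi\,\psi\circ\bar F\,d\bar\mu_Y$ for $\phi\in L^1(\bar Y)$, $\psi\in L^\infty(\bar Y)$, and acting on $\mathbb R^d$-valued functions coordinatewise. **Theorem.** Suppose that $r\in L^p(Y,\mu_Y)$ for some $1\le p<\infty$. Then there exist $\bar m\in L^p(\bar Y,\bar\mu_Y;\mathbb R^d)$ and $\chi\in L^p(Y,\mu_Y;\mathbb R^d)$ such that *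 (a) $V=\bar m\circ\pi+\chi\circ F-\chi$ $\mu_Y$-almost everywhere, * (b) $\bar m\in\ker L$, i.e. $L\bar m=0$ $\bar\mu_Y$-almost everywhere. -/

import Mathlib

open MeasureTheory Set Filter Topology
open scoped NNReal ENNReal

noncomputable section

/-! ### Gibbs-Markov maps -/

section GibbsMarkov

variable {X : Type*}

/-- The separation time of `x` and `y` under `T` with respect to the partition `P`: the least
`n ≥ 0` such that `T^n x` and `T^n y` lie in distinct elements of `P`
(`⊤` if there is no such `n`). -/
def separationTime (T : X → X) (P : Set (Set X)) (x y : X) : ℕ∞ :=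
  ⨅ (n : ℕ) (_ : ¬ ∃ a ∈ P, T^[n] x ∈ a ∧ T^[n] y ∈ a), (n : ℕ∞)

/-- The symbolic distance `d_θ(x, y) = θ ^ s(x, y)`, with `θ ^ ∞ = 0`. -/
def symbolicDist (T : X → X) (P : Set (Set X)) (θ : ℝ) (x y : X) : ℝ :=
  if separationTime T P x y = ⊤ then 0 else θ ^ (separationTime T P x y).toNat

variable [MeasurableSpace X]

/-- The measure `μ ∘ T`, given by `(μ ∘ T)(A) = ∑_{a ∈ P} μ (T (A ∩ a))`, for a map `T` that is
injective on every element of the countable partition `P`. -/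
def imageMeasure (T : X → X) (μ : Measure X) (P : Set (Set X)) : Measure X :=
  Measure.sum fun a : P => (μ.comap ((a : Set X).domRestrict T)).map Subtype.val

/-- `T` is (strongly) mixing for `μ`. -/
def IsMixing (T : X → X) (μ : Measure X) : Prop :=
  ∀ A B : Set X, MeasurableSet A → MeasurableSet B →
    Tendsto (fun n : ℕ => μ (A ∩ T^[n] ⁻¹' B)) atTop (𝓝 (μ A * μ B))

/-- `T` is a Gibbs-Markov map of the probability space `(X, μ)` with countable measurable
partition `P`. (Used on standard Borel spaces.) -/
structure IsGibbsMarkov (T : X → X) (μ : Measure X) (P : Set (Set X)) : Prop where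
  isProbabilityMeasure : IsProbabilityMeasure μ
  countable : P.Countable
  isPartition : Setoid.IsPartition P
  measurableSet : ∀ a ∈ P, MeasurableSet a
  /-- `T` preserves `μ` and is ergodic. -/
  ergodic : Ergodic T μ
  injOn : ∀ a ∈ P, InjOn T a
  /-- The image of a partition element is a union of partition elements. -/
  markov : ∀ a ∈ P, ∃ Q ⊆ P, T '' a = ⋃₀ Q
  /-- The partition separates orbits. -/
  separates : ∀ x y, x ≠ y → separationTime T P x y ≠ ⊤
  /-- The density `g = dμ / d(μ ∘ T)` has a version whose logarithm is `d_θ`-Lipschitz on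
  partition elements, uniformly over the elements, for some `θ ∈ (0, 1)`. -/
  distortion : ∃ θ : ℝ, 0 < θ ∧ θ < 1 ∧ ∃ g : X → ℝ, Measurable g ∧ (∀ x, 0 < g x) ∧
    μ = (imageMeasure T μ P).withDensity (fun x => ENNReal.ofReal (g x)) ∧
    ∃ K : ℝ, ∀ a ∈ P, ∀ x ∈ a, ∀ y ∈ a,
      |Real.log (g x) - Real.log (g y)| ≤ K * symbolicDist T P θ x y
  /-- Images of partition elements have measure bounded below. -/
  bigImages : ∃ δ : ℝ≥0∞, 0 < δ ∧ ∀ a ∈ P, δ ≤ μ (T '' a)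

/-- The transfer operator of `T` on real functions: for integrable `φ` it is the density with
respect to `μ` of the push-forward under `T` of the signed measure `φ dμ`. -/
def transferOperator (T : X → X) (μ : Measure X) (φ : X → ℝ) : X → ℝ :=
  SignedMeasure.rnDeriv ((μ.withDensityᵥ φ).map T) μ

theorem integrable_transferOperator {X : Type*} [MeasurableSpace X] (T : X → X) (μ : Measure X)
    (φ : X → ℝ) : Integrable (transferOperator T μ φ) μ :=
  SignedMeasure.integrable_rnDeriv _ _

theorem setIntegral_transferOperator {X : Type*} [MeasurableSpace X] {T : X → X} {μ : Measure X}
    [IsFiniteMeasure μ] (hT : MeasurePreserving T μ μ) {φ : X → ℝ} (hφ : Integrable φ μ)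
    {A : Set X} (hA : MeasurableSet A) :
    ∫ x in A, transferOperator T μ φ x ∂μ = ∫ x in T ⁻¹' A, φ x ∂μ := by
  have hac : ((μ.withDensityᵥ φ).map T) ≪ᵥ μ.toENNRealVectorMeasure := by
    refine VectorMeasure.AbsolutelyContinuous.mk fun s hs h0 => ?_
    rw [Measure.toENNRealVectorMeasure_apply_measurable hs] at h0
    rw [VectorMeasure.map_apply _ hT.measurable hs, withDensityᵥ_apply hφ (hT.measurable hs)]
    exact setIntegral_measure_zero _ (by rw [hT.measure_preimage hs.nullMeasurableSet, h0])
  have h := SignedMeasure.withDensityᵥ_rnDeriv_eq _ μ hac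
  rw [← withDensityᵥ_apply (integrable_transferOperator T μ φ) hA, transferOperator, h,
    VectorMeasure.map_apply _ hT.measurable hA, withDensityᵥ_apply hφ (hT.measurable hA)]

/-- The duality that characterizes the transfer operator. -/
theorem integral_transferOperator_mul {X : Type*} [MeasurableSpace X] {T : X → X} {μ : Measure X}
    [IsFiniteMeasure μ] (hT : MeasurePreserving T μ μ) {φ ψ : X → ℝ} (hφ : Integrable φ μ)
    (hψ : MemLp ψ ∞ μ) :
    ∫ x, transferOperator T μ φ x * ψ x ∂μ = ∫ x, φ x * ψ (T x) ∂μ := by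
  have hm := hT.measurable.comap_le
  have hL := integrable_transferOperator T μ φ
  have hLs : StronglyMeasurable (transferOperator T μ φ) :=
    (SignedMeasure.measurable_rnDeriv _ _).stronglyMeasurable
  have hce : (fun x => transferOperator T μ φ (T x)) =ᵐ[μ]
      μ[φ | MeasurableSpace.comap T inferInstance] := by
    refine ae_eq_condExp_of_forall_setIntegral_eq hm hφ
      (fun s _ _ => ((hT.integrable_comp hL.1).2 hL).integrableOn) ?_ ?_
    · rintro s ⟨A, hA, rfl⟩ -
      rw [← setIntegral_transferOperator hT hφ hA]
      have h := setIntegral_map (μ := μ) (f := transferOperator T μ φ) hA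
        hLs.aestronglyMeasurable hT.aemeasurable
      rw [hT.map_eq] at h
      exact h.symm
    · exact (hLs.comp_measurable (comap_measurable T)).aestronglyMeasurable
  -- reduce to a measurable representative of `ψ`
  obtain ⟨ψ', hψ', hψe⟩ := hψ.1
  have hψ'm : MemLp ψ' ∞ μ := hψ.ae_eq hψe
  have hψT : MemLp (fun x => ψ' (T x)) ∞ μ := hψ'm.comp_measurePreserving hT
  have hint : Integrable (φ * fun x => ψ' (T x)) μ := hφ.mul_of_top_left hψT
  have hpull := condExp_mul_of_aestronglyMeasurable_right
    (m := MeasurableSpace.comap T inferInstance)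
    (hψ'.comp_measurable (comap_measurable T)).aestronglyMeasurable hint hφ
  calc ∫ x, transferOperator T μ φ x * ψ x ∂μ
      = ∫ x, transferOperator T μ φ x * ψ' x ∂μ :=
        integral_congr_ae (hψe.mono fun x hx => by simp only [hx])
    _ = ∫ x, transferOperator T μ φ (T x) * ψ' (T x) ∂μ := by
        have h := integral_map (μ := μ) (f := fun x => transferOperator T μ φ x * ψ' x)
          hT.aemeasurable (hLs.mul hψ').aestronglyMeasurable
        rw [hT.map_eq] at h
        exact h
    _ = ∫ x, (μ[φ * fun x => ψ' (T x) | MeasurableSpace.comap T inferInstance]) x ∂μ := by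
        refine integral_congr_ae ?_
        filter_upwards [hce, hpull] with x h1 h2
        exact (h2.trans (by rw [Pi.mul_apply, ← h1]; rfl)).symm
    _ = ∫ x, φ x * ψ' (T x) ∂μ := integral_condExp hm
    _ = ∫ x, φ x * ψ (T x) ∂μ := by
        refine integral_congr_ae ?_
        filter_upwards [hT.quasiMeasurePreserving.ae_eq_comp hψe] with x hx
        simp only [Function.comp_apply] at hx
        rw [hx]

/-- The transfer operator on `ℝ^d`-valued functions, acting on each coordinate. -/
def vectorTransferOperator {d : ℕ} (T : X → X) (μ : Measure X)
    (φ : X → EuclideanSpace ℝ (Fin d)) : X → EuclideanSpace ℝ (Fin d) :=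
  fun x => WithLp.toLp 2 fun i => transferOperator T μ (fun y => φ y i) x

end GibbsMarkov

/-! ### Inducing scheme -/

/-- An inducing scheme with stable leaves on `M`: a map `f : M → M`, a subset `Y`, an inducing time
`r : Y → ℤ⁺` with `f^{r(y)} y ∈ Y`, constant on the elements of a countable partition of `Y`,
a measurable partition of `Y` into stable leaves that refines it, and an unstable leaf. -/
structure InducingScheme (M : Type*) [MeasurableSpace M] where
  f : M → M
  measurable_f : Measurable f
  Y : Set M
  measurableSet_Y : MeasurableSet Y
  r : Y → ℕ
  r_pos : ∀ y, 0 < r y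
  returns : ∀ y : Y, f^[r y] (y : M) ∈ Y
  /-- The countable partition `{Y_j}` of `Y`. -/
  parts : Set (Set Y)
  parts_countable : parts.Countable
  parts_isPartition : Setoid.IsPartition parts
  parts_measurableSet : ∀ a ∈ parts, MeasurableSet a
  r_const : ∀ a ∈ parts, ∀ y ∈ a, ∀ y' ∈ a, r y = r y'
  /-- `y` and `y'` lie in the same stable leaf, `y' ∈ W^s(y)`. -/
  stable : Setoid Y
  /-- The partition into stable leaves is measurable: countably many measurable unions of leaves
  separate the leaves. -/
  stable_measurable : MeasurableSpace.CountablySeparated (Quotient stable)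
  /-- Every `Y_j` is a union of stable leaves. -/
  stable_subset : ∀ a ∈ parts, ∀ y ∈ a, ∀ y', stable y y' → y' ∈ a
  /-- The unstable leaf `W^u`. -/
  unstable : Set Y
  unstable_measurableSet : MeasurableSet unstable
  unstable_existsUnique : ∀ y, ∃! z, z ∈ unstable ∧ stable y z

namespace InducingScheme

section Measurable

variable {M : Type*} [MeasurableSpace M] (S : InducingScheme M)

/-- The induced map `F = f^r : Y → Y`. -/
def F (y : S.Y) : S.Y := ⟨S.f^[S.r y] (y : M), S.returns y⟩

/-- The quotient `Ȳ` of `Y` along stable leaves, with the quotient `σ`-algebra. -/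
abbrev Ybar : Type _ := Quotient S.stable

/-- The projection `π : Y → Ȳ`. -/
def proj (y : S.Y) : S.Ybar := Quotient.mk S.stable y

/-- `F` maps stable leaves into stable leaves: `F (W^s(y)) ⊆ W^s(F y)`. -/
def PreservesLeaves : Prop :=
  ∀ y y', S.stable y y' → S.stable (S.F y) (S.F y')

/-- The quotient map `F̄ : Ȳ → Ȳ`. -/
def Fbar (h : S.PreservesLeaves) : S.Ybar → S.Ybar :=
  Quotient.map S.F fun y y' hy => h y y' hy

/-- The partition `α` of `Ȳ` formed by the images of the `Y_j`. -/
def alpha : Set (Set S.Ybar) := (fun a => S.proj '' a) '' S.parts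

/-- The measure `μ̄_Y = π_* μ_Y`. -/
def muBar (μ : Measure S.Y) : Measure S.Ybar := μ.map S.proj

/-- `F̄` is a mixing Gibbs-Markov map with partition `α` for `μ̄_Y = π_* μ_Y`. -/
def QuotientMixingGibbsMarkov (h : S.PreservesLeaves) (μ : Measure S.Y) : Prop :=
  IsGibbsMarkov (S.Fbar h) (S.muBar μ) S.alpha ∧ IsMixing (S.Fbar h) (S.muBar μ)

/-- The tower measure `μ_Δ = (μ_Y × counting) / ∫ r dμ_Y` on
`Δ = {(y, ℓ) : 0 ≤ ℓ < r(y)}`, seen as a measure on `Y × ℕ`. -/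
def towerMeasure (μ : Measure S.Y) : Measure (S.Y × ℕ) :=
  (∫⁻ y, (S.r y : ℝ≥0∞) ∂μ)⁻¹ • (μ.prod Measure.count).restrict {q | q.2 < S.r q.1}

/-- The measure `μ_M = (π_Δ)_* μ_Δ` on `M`, where `π_Δ(y, ℓ) = f^ℓ y`. -/
def muM (μ : Measure S.Y) : Measure M :=
  (S.towerMeasure μ).map fun q => S.f^[q.2] (q.1 : M)

/-- The induced observable `V(y) = ∑_{ℓ < r(y)} v(f^ℓ y)`. -/
def inducedObservable {E : Type*} [AddCommMonoid E] (v : M → E) (y : S.Y) : E :=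
  ∑ l ∈ Finset.range (S.r y), v (S.f^[l] (y : M))

end Measurable

section Metric

variable {M : Type*} [MeasurableSpace M] [MetricSpace M] (S : InducingScheme M)

/-- Exponential contraction along stable leaves and exponential expansion along the unstable
leaf, at returns to `Y`. -/
def IsUniformlyHyperbolic : Prop :=
  ∃ C γ₀ : ℝ, 1 ≤ C ∧ 0 < γ₀ ∧ γ₀ < 1 ∧
    (∀ y y' : S.Y, S.stable y y' → ∀ j l : ℕ, l ≤ S.r (S.F^[j] y) →
      dist (S.f^[l] (S.F^[j] y : M)) (S.f^[l] (S.F^[j] y' : M)) ≤ C * γ₀ ^ j) ∧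
    (∀ y ∈ S.unstable, ∀ y' ∈ S.unstable, ∀ n : ℕ, separationTime S.F S.parts y y' = n →
      ∀ j l : ℕ, l ≤ S.r (S.F^[j] y) →
      dist (S.f^[l] (S.F^[j] y : M)) (S.f^[l] (S.F^[j] y' : M)) ≤ C * γ₀ ^ ((n : ℤ) - (j : ℤ)))

end Metric

end InducingScheme

/-- `v` is a (bounded) Hölder observable: `|v|_∞ < ∞` and `|v|_η < ∞` for some `η ∈ (0, 1]`. -/
def IsHolderObservable {M E : Type*} [MetricSpace M] [NormedAddCommGroup E] (v : M → E) : Prop :=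
  (∃ B : ℝ, ∀ x, ‖v x‖ ≤ B) ∧ ∃ C η : ℝ≥0, 0 < η ∧ η ≤ 1 ∧ HolderWith C η v

end

/-!
Replacing `V ∘ F^j` by its value at the unstable point of the leaf changes it by at most a
constant multiple of `γ^j (r ∘ F^j)`. Comparing the replacement at time `j` with the one at time
`j - 1` shows that `V` is cohomologous to `∑ⱼ Uⱼ ∘ π`, where `Uⱼ` is a function on the quotient of
size `O(θ^j (r ∘ F̄^j))` which oscillates by `O(θ^s)` on points of separation time `s` only after
`j` iterations. Hence `L^j Uⱼ` is a regular function, and bounded distortion together with mixing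
gives `‖L^n (Uⱼ - ∫ Uⱼ)‖_p ≤ C ν^(n + j)` for some `ν < 1`. So `∑ₙ L^n w` converges in `L^p` for
`w = ∑ⱼ Uⱼ`, and with `χ = ∑_{n ≥ 1} L^n w` Gordin's decomposition `w = m + χ ∘ F̄ - χ` has
`L m = 0`.
-/

/-! ### Separation times -/

section Separation

variable {X : Type*} {T : X → X} {P : Set (Set X)} {θ : ℝ} {x y : X}

theorem natCast_le_separationTime {n : ℕ} :
    (n : ℕ∞) ≤ separationTime T P x y ↔ ∀ i < n, ∃ a ∈ P, T^[i] x ∈ a ∧ T^[i] y ∈ a := by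
  simp only [separationTime, le_iInf_iff, Nat.cast_le]
  constructor
  · intro h i hi
    by_contra hne
    exact absurd (h i hne) (by omega)
  · intro h i hne
    by_contra hi
    exact hne (h i (by omega))

theorem separationTime_pos : 0 < separationTime T P x y ↔ ∃ a ∈ P, x ∈ a ∧ y ∈ a := by
  rw [← Order.one_le_iff_pos, ← Nat.cast_one, natCast_le_separationTime]
  simp

theorem separationTime_eq_add_one (h : ∃ a ∈ P, x ∈ a ∧ y ∈ a) :
    separationTime T P x y = separationTime T P (T x) (T y) + 1 := by
  refine ENat.eq_of_forall_natCast_le_iff fun n => ?_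
  rcases n with _ | n
  · simp
  rw [natCast_le_separationTime, Nat.cast_add, Nat.cast_one,
    ENat.add_le_add_iff_right ENat.one_ne_top, natCast_le_separationTime]
  constructor
  · intro H i hi
    simpa only [← Function.iterate_succ_apply] using H (i + 1) (by omega)
  · rintro H (_ | i) hi
    · exact h
    · simpa only [Function.iterate_succ_apply] using H i (by omega)

theorem symbolicDist_nonneg (hθ : 0 ≤ θ) (x y : X) : 0 ≤ symbolicDist T P θ x y := by
  unfold symbolicDist
  split_ifs
  · exact le_rfl
  · positivity

theorem symbolicDist_le_one (hθ : 0 ≤ θ) (hθ1 : θ ≤ 1) (x y : X) :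
    symbolicDist T P θ x y ≤ 1 := by
  unfold symbolicDist
  split_ifs
  · exact zero_le_one
  · exact pow_le_one₀ hθ hθ1

theorem symbolicDist_mono {θ' : ℝ} (hθ : 0 ≤ θ) (h : θ ≤ θ') (x y : X) :
    symbolicDist T P θ x y ≤ symbolicDist T P θ' x y := by
  unfold symbolicDist
  split_ifs
  · exact le_rfl
  · exact pow_le_pow_left₀ hθ h _

theorem symbolicDist_of_eq {n : ℕ} (h : separationTime T P x y = n) :
    symbolicDist T P θ x y = θ ^ n := by
  simp [symbolicDist, h]

theorem symbolicDist_eq_mul (h : ∃ a ∈ P, x ∈ a ∧ y ∈ a) :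
    symbolicDist T P θ x y = θ * symbolicDist T P θ (T x) (T y) := by
  have hs := separationTime_eq_add_one (T := T) h
  by_cases ht : separationTime T P (T x) (T y) = ⊤
  · simp [symbolicDist, hs, ht]
  · obtain ⟨n, hn⟩ := ENat.ne_top_iff_exists.1 ht
    rw [symbolicDist_of_eq hn.symm, symbolicDist_of_eq (n := n + 1) (by rw [hs, ← hn]; rfl),
      pow_succ']

end Separation

/-! ### Log-Lipschitz functions -/

section LogLipschitz

variable {X : Type*} {T : X → X} {P : Set (Set X)} {θ A : ℝ} {φ : X → ℝ≥0∞}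

/-- `log φ` is Lipschitz with constant `A` for the symbolic distance `d_θ`, as long as only points
with separation time greater than `k` are compared. Stated multiplicatively, so that `φ` may take
the values `0` and `∞`. -/
def IsLogLipschitz (T : X → X) (P : Set (Set X)) (θ : ℝ) (k : ℕ) (A : ℝ) (φ : X → ℝ≥0∞) : Prop :=
  ∀ ⦃x y⦄, (k : ℕ∞) < separationTime T P x y →
    φ x ≤ ENNReal.ofReal (Real.exp (A * symbolicDist T P θ x y)) * φ y

theorem IsLogLipschitz.mono {k : ℕ} {A' : ℝ} (hφ : IsLogLipschitz T P θ k A φ) (hθ : 0 ≤ θ)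
    (hA : A ≤ A') : IsLogLipschitz T P θ k A' φ := by
  refine fun x y hxy => (hφ hxy).trans ?_
  gcongr
  exact symbolicDist_nonneg hθ x y

theorem IsLogLipschitz.le_exp_mul (hφ : IsLogLipschitz T P θ 0 A φ) (hθ : 0 ≤ θ) (hθ1 : θ ≤ 1)
    (hA : 0 ≤ A) {a : Set X} (ha : a ∈ P) {x y : X} (hx : x ∈ a) (hy : y ∈ a) :
    φ x ≤ ENNReal.ofReal (Real.exp A) * φ y := by
  refine (hφ (separationTime_pos.2 ⟨a, ha, hx, hy⟩)).trans ?_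
  gcongr
  exact mul_le_of_le_one_right hA (symbolicDist_le_one hθ hθ1 x y)

theorem isLogLipschitz_indicator (hP : Setoid.IsPartition P) (hθ : 0 ≤ θ) (hA : 0 ≤ A)
    {a : Set X} (ha : a ∈ P) : IsLogLipschitz T P θ 0 A (a.indicator 1) := by
  intro x y hxy
  obtain ⟨b, hb, hxb, hyb⟩ := separationTime_pos.1 hxy
  by_cases hxa : x ∈ a
  · obtain rfl := Setoid.eq_of_mem_eqv_class hP.2 ha hxa hb hxb
    simp only [indicator_of_mem hxa, indicator_of_mem hyb, Pi.one_apply, mul_one,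
      ENNReal.one_le_ofReal]
    exact Real.one_le_exp (mul_nonneg hA (symbolicDist_nonneg hθ x y))
  · simp [indicator_of_notMem hxa]

variable [MeasurableSpace X] {μ : Measure X}

theorem IsLogLipschitz.setLIntegral_le (hφ : IsLogLipschitz T P θ 0 A φ)
    (hθ : 0 ≤ θ) (hθ1 : θ ≤ 1) (hA : 0 ≤ A) {a : Set X} (ha : a ∈ P) (hma : MeasurableSet a)
    {x : X} (hx : x ∈ a) :
    ∫⁻ y in a, φ y ∂μ ≤ ENNReal.ofReal (Real.exp A) * φ x * μ a := by
  rw [← setLIntegral_const]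
  exact setLIntegral_mono' hma fun y hy => hφ.le_exp_mul hθ hθ1 hA ha hy hx

end LogLipschitz

/-! ### The transfer operator as a sum over inverse branches -/

section BranchSum

variable {X : Type*} (T : X → X) (P : Set (Set X)) (g : X → ℝ≥0∞)

/-- The contribution of the branch of `T` on `a` to the transfer operator with weight `g`: it sends
`φ` to `(g φ) ∘ (T|_a)⁻¹` on `T '' a`, and to `0` elsewhere. -/
noncomputable def branchOperator (a : Set X) (φ : X → ℝ≥0∞) : X → ℝ≥0∞ :=
  Function.extend (a.domRestrict T) (fun y : a => g y * φ y) 0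

/-- The transfer operator on nonnegative functions, as a sum over inverse branches:
`φ ↦ ∑_{T y = x} g y * φ y`. -/
noncomputable def branchSum (φ : X → ℝ≥0∞) (x : X) : ℝ≥0∞ :=
  ∑' a : P, branchOperator T g a φ x

variable {T P g}

theorem branchOperator_of_notMem {a : Set X} {x : X} (hx : x ∉ T '' a) (φ : X → ℝ≥0∞) :
    branchOperator T g a φ x = 0 := by
  refine Function.extend_apply' _ _ _ ?_
  rintro ⟨y, rfl⟩
  exact hx ⟨y, y.2, rfl⟩

theorem exists_branchOperator_eq {a : Set X} {x : X} (hx : x ∈ T '' a) :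
    ∃ y ∈ a, T y = x ∧ ∀ φ, branchOperator T g a φ x = g y * φ y := by
  have hx' : ∃ y : a, a.domRestrict T y = x := by
    obtain ⟨y, hy, rfl⟩ := hx
    exact ⟨⟨y, hy⟩, rfl⟩
  classical
  exact ⟨hx'.choose, hx'.choose.2, hx'.choose_spec, fun φ => by
    rw [branchOperator, Function.extend_def, dif_pos hx']⟩

theorem branchOperator_add (a : Set X) (φ ψ : X → ℝ≥0∞) (x : X) :
    branchOperator T g a (φ + ψ) x = branchOperator T g a φ x + branchOperator T g a ψ x := by
  by_cases hx : x ∈ T '' a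
  · obtain ⟨y, -, -, hy⟩ := exists_branchOperator_eq (g := g) hx
    simp only [hy, Pi.add_apply, mul_add]
  · simp only [branchOperator_of_notMem hx, zero_add]

theorem branchOperator_mul_comp (a : Set X) (φ ψ : X → ℝ≥0∞) (x : X) :
    branchOperator T g a (fun y => φ y * ψ (T y)) x = branchOperator T g a φ x * ψ x := by
  by_cases hx : x ∈ T '' a
  · obtain ⟨y, -, rfl, hy⟩ := exists_branchOperator_eq (g := g) hx
    simp only [hy, mul_assoc]
  · simp only [branchOperator_of_notMem hx, zero_mul]

theorem branchOperator_mono (a : Set X) {φ ψ : X → ℝ≥0∞} (h : φ ≤ ψ) (x : X) :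
    branchOperator T g a φ x ≤ branchOperator T g a ψ x := by
  by_cases hx : x ∈ T '' a
  · obtain ⟨y, -, -, hy⟩ := exists_branchOperator_eq (g := g) hx
    simp only [hy]
    gcongr
    exact h y
  · simp only [branchOperator_of_notMem hx, le_refl]

theorem branchSum_add (φ ψ : X → ℝ≥0∞) :
    branchSum T P g (φ + ψ) = branchSum T P g φ + branchSum T P g ψ := by
  ext x
  simp only [branchSum, Pi.add_apply, ← ENNReal.tsum_add, branchOperator_add]

theorem branchSum_mul_comp (φ ψ : X → ℝ≥0∞) :
    branchSum T P g (fun y => φ y * ψ (T y)) = fun x => branchSum T P g φ x * ψ x := by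
  ext x
  simp only [branchSum, ← ENNReal.tsum_mul_right, branchOperator_mul_comp]

theorem monotone_branchSum : Monotone (branchSum T P g) :=
  fun _ _ h x => ENNReal.tsum_le_tsum fun a => branchOperator_mono a h x

theorem branchSum_const_mul (c : ℝ≥0∞) (φ : X → ℝ≥0∞) :
    branchSum T P g (fun y => c * φ y) = fun x => c * branchSum T P g φ x := by
  simpa only [mul_comm c] using branchSum_mul_comp φ fun _ => c

theorem iterate_branchSum_add (φ ψ : X → ℝ≥0∞) (n : ℕ) :
    (branchSum T P g)^[n] (φ + ψ) = (branchSum T P g)^[n] φ + (branchSum T P g)^[n] ψ := by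
  induction n generalizing φ ψ with
  | zero => rfl
  | succ n ih => simp only [Function.iterate_succ_apply, branchSum_add, ih]

theorem iterate_branchSum_const_mul (c : ℝ≥0∞) (φ : X → ℝ≥0∞) (n : ℕ) :
    (branchSum T P g)^[n] (fun y => c * φ y) = fun x => c * (branchSum T P g)^[n] φ x := by
  induction n generalizing φ with
  | zero => rfl
  | succ n ih => simp only [Function.iterate_succ_apply, branchSum_const_mul, ih]

theorem iterate_branchSum_mul_comp (φ ψ : X → ℝ≥0∞) (n : ℕ) :
    (branchSum T P g)^[n] (fun y => φ y * ψ (T^[n] y)) =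
      fun x => (branchSum T P g)^[n] φ x * ψ x := by
  induction n generalizing φ with
  | zero => rfl
  | succ n ih =>
    simp only [Function.iterate_succ_apply]
    rw [branchSum_mul_comp φ fun x => ψ (T^[n] x), ih]

end BranchSum

/-! ### Gibbs maps -/

section GibbsMap

variable {X : Type*} [MeasurableSpace X] {T : X → X} {μ : Measure X} {P : Set (Set X)} {θ K : ℝ}
  {δ : ℝ≥0∞} {g : X → ℝ≥0∞}

theorem setLIntegral_imageMeasure (hP : Setoid.IsPartition P) {a : Set X} (ha : a ∈ P)
    (hma : MeasurableSet a) {ψ : X → ℝ≥0∞} (hψ : Measurable ψ) :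
    ∫⁻ x in a, ψ x ∂(imageMeasure T μ P) = ∫⁻ y : a, ψ y ∂(μ.comap (a.domRestrict T)) := by
  have hψa : Measurable (a.indicator ψ) := hψ.indicator hma
  rw [← lintegral_indicator hma, imageMeasure, lintegral_sum_measure, tsum_eq_single (⟨a, ha⟩ : P)]
  · rw [lintegral_map hψa measurable_subtype_coe]
    exact lintegral_congr fun y => indicator_of_mem y.2 ψ
  · intro b hb
    rw [lintegral_map hψa measurable_subtype_coe]
    refine (lintegral_congr fun y => indicator_of_notMem (fun hy => hb ?_) ψ).trans lintegral_zero
    exact Subtype.ext (Setoid.eq_of_mem_eqv_class hP.2 b.2 y.2 ha hy)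

theorem lintegral_branchOperator_eq_comap {a : Set X} (he : MeasurableEmbedding (a.domRestrict T))
    (φ : X → ℝ≥0∞) :
    ∫⁻ x, branchOperator T g a φ x ∂μ = ∫⁻ y : a, g y * φ y ∂(μ.comap (a.domRestrict T)) := by
  rw [← setLIntegral_eq_of_support_subset (s := range (a.domRestrict T)), ← he.map_comap,
    he.lintegral_map]
  · exact lintegral_congr fun y => he.injective.extend_apply _ _ y
  · intro x hx
    rw [Set.range_domRestrict]
    by_contra hne
    exact hx (branchOperator_of_notMem hne φ)

/-- The form of the Gibbs-Markov property used for transfer operators: the density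
`g = dμ / d(μ ∘ T)` is log-Lipschitz with constant `K`, the branches are measurable embeddings, and
their images have measure at least `δ`. The map `T` need not be ergodic. -/
structure IsGibbsMap (T : X → X) (μ : Measure X) (P : Set (Set X)) (θ K : ℝ)
    (δ : ℝ≥0∞) (g : X → ℝ≥0∞) : Prop where
  isProbabilityMeasure : IsProbabilityMeasure μ
  countable : P.Countable
  isPartition : Setoid.IsPartition P
  measurableSet : ∀ a ∈ P, MeasurableSet a
  measurePreserving : MeasurePreserving T μ μ
  measurableEmbedding : ∀ a ∈ P, MeasurableEmbedding (a.domRestrict T)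
  markov : ∀ a ∈ P, ∃ Q ⊆ P, T '' a = ⋃₀ Q
  theta_pos : 0 < θ
  theta_lt_one : θ < 1
  nonneg : 0 ≤ K
  measurable_density : Measurable g
  withDensity_eq : μ = (imageMeasure T μ P).withDensity g
  distortion : IsLogLipschitz T P θ 0 K g
  delta_pos : 0 < δ
  bigImages : ∀ a ∈ P, δ ≤ μ (T '' a)

theorem IsGibbsMarkov.exists_isGibbsMap (h : IsGibbsMarkov T μ P)
    (hemb : ∀ a ∈ P, MeasurableEmbedding (a.domRestrict T)) {γ : ℝ} (hγ1 : γ < 1) :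
    ∃ θ K δ g, γ ≤ θ ∧ IsGibbsMap T μ P θ K δ g := by
  obtain ⟨θ, hθ0, hθ1, g, hg, hgpos, hμ, K, hK⟩ := h.distortion
  obtain ⟨δ, hδ, hδP⟩ := h.bigImages
  refine ⟨max θ γ, |K|, δ, fun x => ENNReal.ofReal (g x), le_max_right _ _,
    h.isProbabilityMeasure, h.countable, h.isPartition, h.measurableSet,
    h.ergodic.toMeasurePreserving, hemb, h.markov, lt_max_of_lt_left hθ0, max_lt hθ1 hγ1,
    abs_nonneg K, hg.ennreal_ofReal, hμ, ?_, hδ, hδP⟩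
  intro x y hxy
  obtain ⟨a, ha, hx, hy⟩ := separationTime_pos.1 hxy
  rw [← ENNReal.ofReal_mul (Real.exp_pos _).le]
  refine ENNReal.ofReal_le_ofReal ?_
  rw [← Real.log_le_log_iff (hgpos x) (by have := hgpos y; positivity),
    Real.log_mul (Real.exp_pos _).ne' (hgpos y).ne', Real.log_exp]
  have hlog := (le_abs_self _).trans (hK a ha x hx y hy)
  have hdist : K * symbolicDist T P θ x y ≤ |K| * symbolicDist T P (max θ γ) x y :=
    mul_le_mul (le_abs_self K) (symbolicDist_mono hθ0.le (le_max_left _ _) x y)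
      (symbolicDist_nonneg hθ0.le x y) (abs_nonneg K)
  linarith

namespace IsGibbsMap

variable (h : IsGibbsMap T μ P θ K δ g)
include h

theorem pairwise_disjoint : Pairwise (Function.onFun Disjoint fun a : P => (a : Set X)) :=
  fun a b hab => Set.disjoint_left.2 fun _ hxa hxb =>
    hab (Subtype.ext (Setoid.eq_of_mem_eqv_class h.isPartition.2 a.2 hxa b.2 hxb))

theorem measurable_branchOperator {a : Set X} (ha : a ∈ P) {φ : X → ℝ≥0∞} (hφ : Measurable φ) :
    Measurable (branchOperator T g a φ) :=
  (h.measurableEmbedding a ha).measurable_extend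
    ((h.measurable_density.mul hφ).comp measurable_subtype_coe) measurable_zero

theorem lintegral_branchOperator {a : Set X} (ha : a ∈ P) {φ : X → ℝ≥0∞} (hφ : Measurable φ) :
    ∫⁻ x, branchOperator T g a φ x ∂μ = ∫⁻ x in a, φ x ∂μ := by
  have hma := h.measurableSet a ha
  have hcomap := setLIntegral_imageMeasure (T := T) (μ := μ) h.isPartition ha hma
    (h.measurable_density.mul hφ)
  rw [lintegral_branchOperator_eq_comap (h.measurableEmbedding a ha)]
  refine hcomap.symm.trans ?_
  conv_rhs => rw [h.withDensity_eq]
  rw [restrict_withDensity hma, lintegral_withDensity_eq_lintegral_mul _ h.measurable_density hφ]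

theorem tsum_setLIntegral (φ : X → ℝ≥0∞) : ∑' a : P, ∫⁻ x in a, φ x ∂μ = ∫⁻ x, φ x ∂μ := by
  have := h.countable.to_subtype
  rw [← lintegral_iUnion (fun a : P => h.measurableSet a a.2) h.pairwise_disjoint,
    ← sUnion_eq_iUnion, h.isPartition.sUnion_eq_univ, setLIntegral_univ]

theorem measurable_branchSum {φ : X → ℝ≥0∞} (hφ : Measurable φ) :
    Measurable (branchSum T P g φ) := by
  have := h.countable.to_subtype
  exact Measurable.tsum fun a => h.measurable_branchOperator a.2 hφ

theorem lintegral_branchSum {φ : X → ℝ≥0∞} (hφ : Measurable φ) :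
    ∫⁻ x, branchSum T P g φ x ∂μ = ∫⁻ x, φ x ∂μ := by
  have := h.countable.to_subtype
  simp only [branchSum]
  rw [lintegral_tsum fun a => (h.measurable_branchOperator a.2 hφ).aemeasurable]
  simp only [fun a : P => h.lintegral_branchOperator a.2 hφ, h.tsum_setLIntegral]

theorem measurable_iterate_branchSum {φ : X → ℝ≥0∞} (hφ : Measurable φ) (n : ℕ) :
    Measurable ((branchSum T P g)^[n] φ) := by
  induction n generalizing φ with
  | zero => exact hφ
  | succ _ ih => exact ih (h.measurable_branchSum hφ)

theorem lintegral_iterate_branchSum {φ : X → ℝ≥0∞} (hφ : Measurable φ) (n : ℕ) :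
    ∫⁻ x, (branchSum T P g)^[n] φ x ∂μ = ∫⁻ x, φ x ∂μ := by
  induction n generalizing φ with
  | zero => rfl
  | succ n ih =>
    rw [Function.iterate_succ_apply, ih (h.measurable_branchSum hφ), h.lintegral_branchSum hφ]

theorem setLIntegral_iterate_branchSum {φ : X → ℝ≥0∞} (hφ : Measurable φ) (n : ℕ) {A : Set X}
    (hA : MeasurableSet A) :
    ∫⁻ x in A, (branchSum T P g)^[n] φ x ∂μ = ∫⁻ x in T^[n] ⁻¹' A, φ x ∂μ := by
  have hT := h.measurePreserving.measurable.iterate n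
  have hi : Measurable (A.indicator (1 : X → ℝ≥0∞)) := measurable_one.indicator hA
  have hdual := h.lintegral_iterate_branchSum
    (φ := fun y => φ y * A.indicator 1 (T^[n] y)) (hφ.mul (hi.comp hT)) n
  rw [iterate_branchSum_mul_comp] at hdual
  rw [← lintegral_indicator hA, ← lintegral_indicator (hT hA)]
  convert hdual using 2
  · ext x; by_cases hx : x ∈ A <;> simp [hx]
  · ext x; by_cases hx : T^[n] x ∈ A <;> simp [hx]

theorem iterate_branchSum_const (c : ℝ≥0∞) (n : ℕ) :
    (branchSum T P g)^[n] (fun _ => c) =ᵐ[μ] fun _ => c := by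
  have := h.isProbabilityMeasure
  refine ae_eq_of_forall_setLIntegral_eq_of_sigmaFinite
    (h.measurable_iterate_branchSum measurable_const n) measurable_const fun A hA _ => ?_
  rw [h.setLIntegral_iterate_branchSum measurable_const n hA, setLIntegral_const,
    setLIntegral_const, (h.measurePreserving.iterate n).measure_preimage hA.nullMeasurableSet]

end IsGibbsMap

end GibbsMap

/-! ### The cone of log-Lipschitz densities -/

section Cone

variable {X : Type*} [MeasurableSpace X] {T : X → X} {μ : Measure X} {P : Set (Set X)} {θ K A : ℝ}
  {δ : ℝ≥0∞} {g φ : X → ℝ≥0∞}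

/-- The cone of integrable measurable densities whose logarithm is `A`-Lipschitz for `d_θ` on the
elements of `P`. The transfer operator of a Gibbs map contracts it. -/
structure MemCone (T : X → X) (μ : Measure X) (P : Set (Set X)) (θ A : ℝ) (φ : X → ℝ≥0∞) :
    Prop where
  measurable : Measurable φ
  isLogLipschitz : IsLogLipschitz T P θ 0 A φ
  lintegral_ne_top : ∫⁻ x, φ x ∂μ ≠ ∞

theorem memCone_const [IsFiniteMeasure μ] (hθ : 0 ≤ θ) (hA : 0 ≤ A) {c : ℝ≥0∞} (hc : c ≠ ∞) :
    MemCone T μ P θ A fun _ => c where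
  measurable := measurable_const
  isLogLipschitz x y _ := le_mul_of_one_le_left zero_le <| ENNReal.one_le_ofReal.2 <|
    Real.one_le_exp (mul_nonneg hA (symbolicDist_nonneg hθ x y))
  lintegral_ne_top := by simp [ENNReal.mul_ne_top hc]

namespace IsGibbsMap

variable (h : IsGibbsMap T μ P θ K δ g)
include h

theorem density_mul_le {k : ℕ} (hφ : IsLogLipschitz T P θ k A φ) {x y : X}
    (hxy : (k : ℕ∞) < separationTime T P x y) :
    g x * φ x ≤ ENNReal.ofReal (Real.exp ((K + A) * symbolicDist T P θ x y)) * (g y * φ y) := by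
  have hg := h.distortion ((Nat.cast_nonneg' k).trans_lt hxy)
  refine (mul_le_mul' hg (hφ hxy)).trans_eq ?_
  rw [mul_mul_mul_comm, ← ENNReal.ofReal_mul (Real.exp_pos _).le, ← Real.exp_add, add_mul]

theorem mem_image_of_mem_image {a : Set X} (ha : a ∈ P) {x y : X}
    (hxy : 0 < separationTime T P x y) (hx : x ∈ T '' a) : y ∈ T '' a := by
  obtain ⟨Q, hQ, hQe⟩ := h.markov a ha
  obtain ⟨b, hb, hxb, hyb⟩ := separationTime_pos.1 hxy
  rw [hQe] at hx ⊢
  obtain ⟨b', hb', hxb'⟩ := hx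
  obtain rfl := Setoid.eq_of_mem_eqv_class h.isPartition.2 (hQ hb') hxb' hb hxb
  exact ⟨b', hb', hyb⟩

theorem branchOperator_apply {a : Set X} (ha : a ∈ P) {x : X} (hx : x ∈ a) (φ : X → ℝ≥0∞) :
    branchOperator T g a φ (T x) = g x * φ x :=
  (h.measurableEmbedding a ha).injective.extend_apply (fun y : a => g y * φ y) 0 ⟨x, hx⟩

theorem isLogLipschitz_branchSum {k : ℕ} (hφ : IsLogLipschitz T P θ k A φ) :
    IsLogLipschitz T P θ (k - 1) (θ * (K + A)) (branchSum T P g φ) := by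
  intro x y hxy
  simp only [branchSum, ← ENNReal.tsum_mul_left]
  refine ENNReal.tsum_le_tsum fun ⟨a, ha⟩ => ?_
  by_cases hx : x ∈ T '' a
  swap
  · rw [branchOperator_of_notMem hx]; exact zero_le
  obtain ⟨y, hy, rfl⟩ := h.mem_image_of_mem_image ha ((Nat.cast_nonneg' _).trans_lt hxy) hx
  obtain ⟨x, hx, rfl⟩ := hx
  rw [h.branchOperator_apply ha hx, h.branchOperator_apply ha hy]
  have hk : (k : ℕ∞) < separationTime T P x y := by
    rw [separationTime_eq_add_one ⟨a, ha, hx, hy⟩]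
    refine lt_of_le_of_lt (?_ : (k : ℕ∞) ≤ (k - 1 : ℕ) + 1)
      ((ENat.add_lt_add_iff_right ENat.one_ne_top).2 hxy)
    exact_mod_cast (by omega : k ≤ k - 1 + 1)
  refine (h.density_mul_le hφ hk).trans_eq ?_
  rw [symbolicDist_eq_mul (T := T) (θ := θ) ⟨a, ha, hx, hy⟩]
  ring_nf

theorem isLogLipschitz_iterate_branchSum {j : ℕ} {B : ℝ}
    (hφ : IsLogLipschitz T P θ j (B * θ⁻¹ ^ j + θ * K / (1 - θ)) φ) :
    IsLogLipschitz T P θ 0 (B + θ * K / (1 - θ)) ((branchSum T P g)^[j] φ) := by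
  have hθ := h.theta_pos
  have hθ1 : 1 - θ ≠ 0 := by have := h.theta_lt_one; linarith
  induction j generalizing φ with
  | zero => simpa using hφ
  | succ j ih =>
    have hconst : B * θ⁻¹ ^ j + θ * K / (1 - θ) =
        θ * (K + (B * θ⁻¹ ^ (j + 1) + θ * K / (1 - θ))) := by
      rw [pow_succ]
      field_simp
      ring
    refine ih ?_
    rw [hconst]
    exact h.isLogLipschitz_branchSum hφ

theorem memCone_branchSum (hφ : MemCone T μ P θ A φ) :
    MemCone T μ P θ (θ * (K + A)) (branchSum T P g φ) where
  measurable := h.measurable_branchSum hφ.measurable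
  isLogLipschitz := h.isLogLipschitz_branchSum hφ.isLogLipschitz
  lintegral_ne_top := by rw [h.lintegral_branchSum hφ.measurable]; exact hφ.lintegral_ne_top

theorem memCone_iterate_branchSum (hA : θ * (K + A) ≤ A) (hφ : MemCone T μ P θ A φ) (n : ℕ) :
    MemCone T μ P θ A ((branchSum T P g)^[n] φ) := by
  induction n generalizing φ with
  | zero => exact hφ
  | succ _ ih =>
    have hL := h.memCone_branchSum hφ
    exact ih { hL with isLogLipschitz := hL.isLogLipschitz.mono h.theta_pos.le hA }

theorem delta_ne_top : δ ≠ ∞ := by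
  have := h.isProbabilityMeasure
  obtain ⟨x⟩ := Measure.nonempty_of_neZero μ
  obtain ⟨a, ⟨ha, -⟩, -⟩ := h.isPartition.2 x
  exact ne_top_of_le_ne_top (measure_ne_top μ _) (h.bigImages a ha)

theorem branchOperator_le_mul_branchOperator (hA : 0 ≤ A) (hφ : IsLogLipschitz T P θ 0 A φ)
    {a : Set X} (ha : a ∈ P) {x z : X} (hx : x ∈ T '' a) (hz : z ∈ T '' a) :
    branchOperator T g a φ x ≤
      ENNReal.ofReal (Real.exp (K + A)) * branchOperator T g a φ z := by
  obtain ⟨x, hx, rfl⟩ := hx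
  obtain ⟨z, hz, rfl⟩ := hz
  rw [h.branchOperator_apply ha hx, h.branchOperator_apply ha hz]
  refine (h.density_mul_le hφ (separationTime_pos.2 ⟨a, ha, hx, hz⟩)).trans ?_
  gcongr
  exact mul_le_of_le_one_right (add_nonneg h.nonneg hA)
    (symbolicDist_le_one h.theta_pos.le h.theta_lt_one.le x z)

theorem branchOperator_le (hA : 0 ≤ A) (hφ : MemCone T μ P θ A φ) {a : Set X} (ha : a ∈ P)
    (x : X) : branchOperator T g a φ x ≤
      δ⁻¹ * ENNReal.ofReal (Real.exp (K + A)) * ∫⁻ y in a, φ y ∂μ := by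
  by_cases hx : x ∈ T '' a
  swap
  · rw [branchOperator_of_notMem hx]; exact zero_le
  have hmes : MeasurableSet (T '' a) := by
    simpa only [Set.range_domRestrict] using (h.measurableEmbedding a ha).measurableSet_range
  rw [mul_assoc, ← ENNReal.mul_le_iff_le_inv h.delta_pos.ne' h.delta_ne_top,
    ← h.lintegral_branchOperator ha hφ.measurable]
  calc δ * branchOperator T g a φ x
      ≤ μ (T '' a) * branchOperator T g a φ x := by gcongr; exact h.bigImages a ha
    _ = ∫⁻ _ in T '' a, branchOperator T g a φ x ∂μ := by rw [setLIntegral_const, mul_comm]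
    _ ≤ ∫⁻ z in T '' a, ENNReal.ofReal (Real.exp (K + A)) * branchOperator T g a φ z ∂μ :=
        setLIntegral_mono' hmes fun z hz =>
          h.branchOperator_le_mul_branchOperator hA hφ.isLogLipschitz ha hx hz
    _ ≤ ∫⁻ z, ENNReal.ofReal (Real.exp (K + A)) * branchOperator T g a φ z ∂μ :=
        setLIntegral_le_lintegral _ _
    _ = _ := lintegral_const_mul _ (h.measurable_branchOperator ha hφ.measurable)

theorem branchSum_le (hA : 0 ≤ A) (hφ : MemCone T μ P θ A φ) (x : X) :
    branchSum T P g φ x ≤ δ⁻¹ * ENNReal.ofReal (Real.exp (K + A)) * ∫⁻ x, φ x ∂μ := by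
  rw [← h.tsum_setLIntegral, ← ENNReal.tsum_mul_left]
  exact ENNReal.tsum_le_tsum fun a => h.branchOperator_le hA hφ a.2 x

end IsGibbsMap

end Cone

/-! ### Lower bounds from mixing -/

section Mixing

variable {X : Type*} [MeasurableSpace X] {T : X → X} {μ : Measure X}

theorem IsMixing.eventually_measure_mul_le [IsFiniteMeasure μ] (hmix : IsMixing T μ) {ι : Type*}
    {a : ι → Set X} (ha : ∀ i, MeasurableSet (a i)) {b : Set X} (hb : MeasurableSet b)
    (s : Finset ι) : ∀ᶠ n : ℕ in atTop, ∀ i ∈ s, μ (a i) * μ b ≤ 2 * μ (a i ∩ T^[n] ⁻¹' b) := by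
  rw [Filter.eventually_all_finset]
  intro i _
  by_cases h0 : μ (a i) * μ b = 0
  · simp [h0]
  have hlt : μ (a i) * μ b / 2 < μ (a i) * μ b :=
    ENNReal.half_lt_self h0 (ENNReal.mul_ne_top (measure_ne_top _ _) (measure_ne_top _ _))
  filter_upwards [(hmix (a i) b (ha i) hb).eventually (lt_mem_nhds hlt)] with n hn
  exact ((ENNReal.div_le_iff (by simp) (by simp)).1 hn.le).trans_eq (mul_comm _ _)

theorem exists_finset_measure_compl_biUnion_lt [IsFiniteMeasure μ] {ι : Type*} [Countable ι]
    {a : ι → Set X} (ha : ∀ i, MeasurableSet (a i)) (hU : ⋃ i, a i = univ) {ε : ℝ≥0∞}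
    (hε : ε ≠ 0) : ∃ s : Finset ι, μ (⋃ i ∈ s, a i)ᶜ < ε := by
  have hlim : Tendsto (μ ∘ fun s : Finset ι => (⋃ i ∈ s, a i)ᶜ) atTop (𝓝 0) := by
    have hanti : Antitone fun s : Finset ι => (⋃ i ∈ s, a i)ᶜ := fun s t hst =>
      compl_subset_compl.2 (biUnion_subset_biUnion_left hst)
    have hempty : ⋂ s : Finset ι, (⋃ i ∈ s, a i)ᶜ = ∅ := by
      rw [← compl_iUnion, ← iUnion_eq_iUnion_finset, hU, compl_univ]
    rw [← measure_empty (μ := μ), ← hempty]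
    exact tendsto_measure_iInter_atTop
      (fun s => (s.measurableSet_biUnion fun i _ => ha i).compl.nullMeasurableSet) hanti
      ⟨∅, measure_ne_top _ _⟩
  exact (hlim.eventually (gt_mem_nhds (pos_iff_ne_zero.2 hε))).exists

theorem lintegral_le_two_mul_setLIntegral {ψ : X → ℝ≥0∞} {D : ℝ≥0∞}
    (hψ : ∀ x, ψ x ≤ D * ∫⁻ x, ψ x ∂μ) (hfin : ∫⁻ x, ψ x ∂μ ≠ ∞) {U : Set X}
    (hU : MeasurableSet U) (hμU : μ Uᶜ ≤ (2 * D)⁻¹) :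
    ∫⁻ x, ψ x ∂μ ≤ 2 * ∫⁻ x in U, ψ x ∂μ := by
  set I := ∫⁻ x, ψ x ∂μ
  have hcompl : ∫⁻ x in Uᶜ, ψ x ∂μ ≤ I / 2 := by
    calc ∫⁻ x in Uᶜ, ψ x ∂μ ≤ ∫⁻ _ in Uᶜ, D * I ∂μ := lintegral_mono hψ
      _ = D * I * μ Uᶜ := setLIntegral_const _ _
      _ ≤ D * I * (2 * D)⁻¹ := by gcongr
      _ = D * D⁻¹ * (I / 2) := by
          rw [ENNReal.mul_inv (by simp) (by simp), div_eq_mul_inv]; ring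
      _ ≤ 1 * (I / 2) := by gcongr; exact ENNReal.mul_inv_le_one D
      _ = I / 2 := one_mul _
  have hsplit : I / 2 + I / 2 ≤ ∫⁻ x in U, ψ x ∂μ + I / 2 := by
    rw [ENNReal.add_halves]
    exact (lintegral_add_compl ψ hU).symm.le.trans (add_le_add le_rfl hcompl)
  have hhalf := (ENNReal.add_le_add_iff_right (ENNReal.div_ne_top hfin (by simp))).1 hsplit
  rw [mul_comm]
  exact (ENNReal.div_le_iff (by simp) (by simp)).1 hhalf

theorem exists_measure_ne_zero_of_sUnion_eq_univ [NeZero μ] {P : Set (Set X)} (hP : P.Countable)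
    (hU : ⋃₀ P = univ) : ∃ b ∈ P, μ b ≠ 0 := by
  by_contra! H
  have hnull : μ (⋃₀ P) = 0 := (measure_sUnion_null_iff hP).2 H
  rw [hU, Measure.measure_univ_eq_zero] at hnull
  exact NeZero.ne μ hnull

namespace IsGibbsMap

variable {P : Set (Set X)} {θ K A : ℝ} {δ : ℝ≥0∞} {g : X → ℝ≥0∞}
  (h : IsGibbsMap T μ P θ K δ g)
include h

theorem measure_inter_preimage_le (hA : 0 ≤ A) (hAθ : θ * (K + A) ≤ A) {a b : Set X} (ha : a ∈ P)
    (hb : b ∈ P) {x : X} (hx : x ∈ b) (n : ℕ) :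
    μ (a ∩ T^[n] ⁻¹' b) ≤
      ENNReal.ofReal (Real.exp A) * (branchSum T P g)^[n] (a.indicator 1) x := by
  have := h.isProbabilityMeasure
  have hma := h.measurableSet a ha
  have hcone : MemCone T μ P θ A (a.indicator 1) :=
    ⟨measurable_one.indicator hma,
      isLogLipschitz_indicator h.isPartition h.theta_pos.le hA ha, by
        rw [lintegral_indicator_one hma]; exact measure_ne_top μ a⟩
  have hb_le := (h.memCone_iterate_branchSum hAθ hcone n).isLogLipschitz.setLIntegral_le (μ := μ)
    h.theta_pos.le h.theta_lt_one.le hA hb (h.measurableSet b hb) hx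
  rw [h.setLIntegral_iterate_branchSum hcone.measurable n (h.measurableSet b hb),
    lintegral_indicator_one hma, Measure.restrict_apply hma] at hb_le
  exact hb_le.trans (mul_le_of_le_one_right' prob_le_one)

theorem measure_mul_setLIntegral_le (hA : 0 ≤ A) (hAθ : θ * (K + A) ≤ A) {ψ : X → ℝ≥0∞}
    (hψ : MemCone T μ P θ A ψ) {a b : Set X} (ha : a ∈ P) (hb : b ∈ P) {x : X} (hx : x ∈ b)
    {n : ℕ} (hn : μ a * μ b ≤ 2 * μ (a ∩ T^[n] ⁻¹' b)) :
    μ b * ∫⁻ y in a, ψ y ∂μ ≤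
      2 * ENNReal.ofReal (Real.exp A) ^ 2 * (branchSum T P g)^[n] ψ x := by
  have := h.isProbabilityMeasure
  set E := ENNReal.ofReal (Real.exp A)
  set ι := (branchSum T P g)^[n] (a.indicator 1)
  by_cases ha0 : μ a = 0
  · simp [Measure.restrict_eq_zero.2 ha0]
  have hmean : (fun y => (∫⁻ y in a, ψ y ∂μ) * a.indicator 1 y) ≤ fun y => E * μ a * ψ y := by
    intro y
    by_cases hy : y ∈ a
    · simpa [indicator_of_mem hy, mul_right_comm] using hψ.isLogLipschitz.setLIntegral_le (μ := μ)
        h.theta_pos.le h.theta_lt_one.le hA ha (h.measurableSet a ha) hy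
    · simp [indicator_of_notMem hy]
  have hiter := (monotone_branchSum (T := T) (P := P) (g := g)).iterate n hmean x
  simp only [iterate_branchSum_const_mul] at hiter
  have hab : μ a * μ b ≤ 2 * (E * ι x) :=
    hn.trans (mul_le_mul_right (h.measure_inter_preimage_le hA hAθ ha hb hx n) 2)
  refine (ENNReal.mul_le_mul_iff_right ha0 (measure_ne_top _ _)).1 ?_
  calc μ a * (μ b * ∫⁻ y in a, ψ y ∂μ) = μ a * μ b * ∫⁻ y in a, ψ y ∂μ := by ring
    _ ≤ 2 * (E * ι x) * ∫⁻ y in a, ψ y ∂μ := mul_le_mul_left hab _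
    _ = 2 * E * ((∫⁻ y in a, ψ y ∂μ) * ι x) := by ring
    _ ≤ 2 * E * (E * μ a * (branchSum T P g)^[n] ψ x) := by gcongr
    _ = _ := by ring

theorem measure_mul_setLIntegral_biUnion_le (hA : 0 ≤ A) (hAθ : θ * (K + A) ≤ A) {ψ : X → ℝ≥0∞}
    (hψ : MemCone T μ P θ A ψ) {s : Finset P} {b : Set X} (hb : b ∈ P) {x : X} (hx : x ∈ b) {n : ℕ}
    (hn : ∀ a ∈ s, μ a * μ b ≤ 2 * μ (a ∩ T^[n] ⁻¹' b)) :
    μ b * ∫⁻ y in ⋃ a ∈ s, a, ψ y ∂μ ≤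
      2 * s.card * ENNReal.ofReal (Real.exp A) ^ 2 * (branchSum T P g)^[n] ψ x := by
  rw [lintegral_biUnion_finset (h.pairwise_disjoint.set_pairwise _)
    fun a _ => h.measurableSet a a.2, Finset.mul_sum]
  refine (Finset.sum_le_card_nsmul _ _ _ fun a ha =>
    h.measure_mul_setLIntegral_le hA hAθ hψ a.2 hb hx (hn a ha)).trans_eq ?_
  rw [nsmul_eq_mul]
  ring

theorem exists_lintegral_le_iterate (hmix : IsMixing T μ) (hA : 0 ≤ A)
    (hAθ : θ * (K + A) ≤ A) :
    ∃ N : ℕ, ∃ b ∈ P, μ b ≠ 0 ∧ ∃ C : ℝ≥0∞, C ≠ ∞ ∧ ∀ φ, MemCone T μ P θ A φ → ∀ x ∈ b,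
      ∫⁻ x, φ x ∂μ ≤ C * (branchSum T P g)^[N + 1] φ x := by
  have := h.isProbabilityMeasure
  have := h.countable.to_subtype
  set E := ENNReal.ofReal (Real.exp A)
  set D := δ⁻¹ * ENNReal.ofReal (Real.exp (K + A))
  have hD : D ≠ ∞ :=
    ENNReal.mul_ne_top (ENNReal.inv_ne_top.2 h.delta_pos.ne') ENNReal.ofReal_ne_top
  have hmeas : ∀ a : P, MeasurableSet (a : Set X) := fun a => h.measurableSet a a.2
  obtain ⟨b, hb, hb0⟩ :=
    exists_measure_ne_zero_of_sUnion_eq_univ (μ := μ) h.countable h.isPartition.sUnion_eq_univ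
  obtain ⟨s, hs⟩ := exists_finset_measure_compl_biUnion_lt (μ := μ) hmeas
    (by rw [← sUnion_eq_iUnion, h.isPartition.sUnion_eq_univ])
    (ε := (2 * D)⁻¹) (ENNReal.inv_ne_zero.2 (ENNReal.mul_ne_top (by simp) hD))
  obtain ⟨N, hN⟩ := (hmix.eventually_measure_mul_le hmeas (hmeas ⟨b, hb⟩) s).exists
  refine ⟨N, b, hb, hb0, 4 * s.card * E ^ 2 / μ b, ?_, fun φ hφ x hx => ?_⟩
  · have : E ≠ ∞ := ENNReal.ofReal_ne_top
    finiteness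
  set ψ := branchSum T P g φ
  have hψ : MemCone T μ P θ A ψ := h.memCone_iterate_branchSum hAθ hφ 1
  have hψi : ∫⁻ x, ψ x ∂μ = ∫⁻ x, φ x ∂μ := h.lintegral_branchSum hφ.measurable
  have hmass := lintegral_le_two_mul_setLIntegral (by rw [hψi]; exact h.branchSum_le hA hφ)
    hψ.lintegral_ne_top (s.measurableSet_biUnion fun a _ => hmeas a) hs.le
  rw [Function.iterate_succ_apply, ← hψi, mul_comm, ← mul_div_assoc,
    ENNReal.le_div_iff_mul_le (Or.inl hb0) (Or.inl (measure_ne_top _ _))]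
  calc (∫⁻ x, ψ x ∂μ) * μ b ≤ (2 * ∫⁻ y in ⋃ a ∈ s, a, ψ y ∂μ) * μ b := by gcongr
    _ = 2 * (μ b * ∫⁻ y in ⋃ a ∈ s, a, ψ y ∂μ) := by ring
    _ ≤ 2 * (2 * s.card * E ^ 2 * (branchSum T P g)^[N] ψ x) :=
        mul_le_mul_right (h.measure_mul_setLIntegral_biUnion_le hA hAθ hψ hb hx hN) 2
    _ = _ := by ring

end IsGibbsMap

end Mixing

/-! ### Coupling and exponential decay on the cone -/

section Inequalities

theorem sub_le_exp_mul_sub {A A' t u w κ : ℝ} (hA' : 0 ≤ A') (hA : A' < A) (ht : 0 ≤ t)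
    (ht1 : t ≤ 1) (hu : u ≤ Real.exp (A' * t) * w) (hκ0 : 0 ≤ κ)
    (hκ : κ * (A * Real.exp A) ≤ (A - A') * w) :
    u - κ ≤ Real.exp (A * t) * (w - κ) := by
  have hw : 0 ≤ w := nonneg_of_mul_nonneg_right
    ((mul_nonneg hκ0 (mul_nonneg (hA'.trans hA.le) (Real.exp_pos A).le)).trans hκ) (sub_pos.2 hA)
  have hupper : Real.exp (A * t) - 1 ≤ A * Real.exp A * t := by
    have hle : Real.exp (A * t) ≤ Real.exp A :=
      Real.exp_le_exp.2 (mul_le_of_le_one_right (hA'.trans hA.le) ht1)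
    have htangent : Real.exp (A * t) * (1 - A * t) ≤ 1 := by
      have hone := Real.one_sub_le_exp_neg (A * t)
      rw [Real.exp_neg] at hone
      exact (mul_le_mul_of_nonneg_left hone (Real.exp_pos _).le).trans_eq
        (mul_inv_cancel₀ (Real.exp_pos _).ne')
    nlinarith [mul_nonneg (hA'.trans hA.le) ht]
  have hlower : (A - A') * t ≤ Real.exp (A * t) - Real.exp (A' * t) := by
    have hexp : Real.exp (A * t) = Real.exp (A' * t) * Real.exp ((A - A') * t) := by
      rw [← Real.exp_add]; ring_nf
    have hone : 1 ≤ Real.exp (A' * t) := Real.one_le_exp (mul_nonneg hA' ht)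
    have hadd := Real.add_one_le_exp ((A - A') * t)
    nlinarith [mul_nonneg (sub_pos.2 hA).le ht]
  have hcost : κ * (Real.exp (A * t) - 1) ≤ (Real.exp (A * t) - Real.exp (A' * t)) * w :=
    calc κ * (Real.exp (A * t) - 1) ≤ κ * (A * Real.exp A * t) := by gcongr
      _ = κ * (A * Real.exp A) * t := by ring
      _ ≤ (A - A') * w * t := by gcongr
      _ = (A - A') * t * w := by ring
      _ ≤ (Real.exp (A * t) - Real.exp (A' * t)) * w := by gcongr
  linarith

theorem exists_pow_div_le {τ : ℝ} (hτ : 0 ≤ τ) (hτ1 : τ < 1) {k : ℕ} (hk : k ≠ 0) :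
    ∃ C ν : ℝ, 0 ≤ C ∧ 0 < ν ∧ ν < 1 ∧ ∀ n : ℕ, τ ^ (n / k) ≤ C * ν ^ n := by
  set s : ℝ := max τ (1 / 2)
  have hs : 0 < s := lt_max_of_lt_right (by norm_num)
  have hs1 : s < 1 := max_lt hτ1 (by norm_num)
  set ν : ℝ := s ^ ((k : ℝ)⁻¹)
  have hν : 0 < ν := Real.rpow_pos_of_pos hs _
  have hν1 : ν < 1 := Real.rpow_lt_one hs.le hs1 (by positivity)
  have hνk : ν ^ k = s := Real.rpow_inv_natCast_pow hs.le hk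
  refine ⟨s⁻¹, ν, by positivity, hν, hν1, fun n => ?_⟩
  calc τ ^ (n / k) ≤ s ^ (n / k) := pow_le_pow_left₀ hτ (le_max_left _ _) _
    _ = s⁻¹ * ν ^ (k * (n / k + 1)) := by
        rw [pow_mul, hνk, pow_succ', inv_mul_cancel_left₀ hs.ne']
    _ ≤ s⁻¹ * ν ^ n := by
        refine mul_le_mul_of_nonneg_left (pow_le_pow_of_le_one hν.le hν1.le ?_) (by positivity)
        exact (Nat.lt_mul_div_succ n (Nat.pos_of_ne_zero hk)).le

theorem le_of_mul_ofReal_mul_exp_le {A A' : ℝ} (hA' : 0 ≤ A') (hA : A' < A) {κ w : ℝ≥0∞}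
    (h : κ * ENNReal.ofReal (A * Real.exp A) ≤ ENNReal.ofReal (A - A') * w) : κ ≤ w := by
  have hpos : 0 < A * Real.exp A := mul_pos (hA'.trans_lt hA) (Real.exp_pos A)
  have hle : A - A' ≤ A * Real.exp A := (sub_le_self A hA').trans
    (le_mul_of_one_le_right (hA'.trans hA.le) (Real.one_le_exp (hA'.trans hA.le)))
  rw [mul_comm] at h
  exact (ENNReal.mul_le_mul_iff_right (ENNReal.ofReal_pos.2 hpos).ne' ENNReal.ofReal_ne_top).1
    (h.trans (mul_le_mul_left (ENNReal.ofReal_le_ofReal hle) w))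

theorem exists_mul_mul_le_of_le_mul {C E R : ℝ≥0∞} (hC : C ≠ ∞) (hE0 : E ≠ 0) (hE : E ≠ ∞)
    (hR0 : R ≠ 0) (hR : R ≠ ∞) :
    ∃ κ : ℝ≥0∞, κ ≠ 0 ∧ κ ≠ ∞ ∧ ∀ I w : ℝ≥0∞, I ≤ C * w → I * κ * E ≤ R * w := by
  have hEC0 : E * (C + 1) ≠ 0 := mul_ne_zero hE0 (by simp)
  have hEC : E * (C + 1) ≠ ∞ := by finiteness
  refine ⟨R / (E * (C + 1)), ENNReal.div_ne_zero.2 ⟨hR0, hEC⟩, ENNReal.div_ne_top hR hEC0,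
    fun I w hI => ?_⟩
  calc I * (R / (E * (C + 1))) * E ≤ (C + 1) * w * (R / (E * (C + 1))) * E := by
        gcongr
        exact hI.trans (mul_le_mul_left le_self_add w)
    _ = R / (E * (C + 1)) * (E * (C + 1)) * w := by ring
    _ = R * w := by rw [ENNReal.div_mul_cancel hEC0 hEC]

end Inequalities

section Coupling

variable {X : Type*} {T : X → X} {P : Set (Set X)} {θ K A A' : ℝ} {δ : ℝ≥0∞} {g φ : X → ℝ≥0∞}

theorem IsLogLipschitz.sub_indicator (hφ : IsLogLipschitz T P θ 0 A' φ)
    (hP : Setoid.IsPartition P) (hθ : 0 ≤ θ) (hθ1 : θ ≤ 1) (hA' : 0 ≤ A') (hA : A' < A)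
    {b : Set X} (hb : b ∈ P) {κ : ℝ≥0∞} (hκ : κ ≠ ∞)
    (hκφ : ∀ x ∈ b, κ * ENNReal.ofReal (A * Real.exp A) ≤ ENNReal.ofReal (A - A') * φ x) :
    IsLogLipschitz T P θ 0 A fun x => φ x - b.indicator (fun _ => κ) x := by
  intro x y hxy
  have ht := symbolicDist_nonneg (T := T) (P := P) hθ x y
  have ht1 := symbolicDist_le_one (T := T) (P := P) hθ hθ1 x y
  obtain ⟨a, ha, hxa, hya⟩ := separationTime_pos.1 hxy
  by_cases hxb : x ∈ b
  swap
  · have hyb : y ∉ b := fun hyb =>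
      hxb (Setoid.eq_of_mem_eqv_class hP.2 ha hya hb hyb ▸ hxa)
    simpa only [indicator_of_notMem hxb, indicator_of_notMem hyb, tsub_zero] using
      hφ.mono hθ hA.le hxy
  obtain rfl := Setoid.eq_of_mem_eqv_class hP.2 ha hxa hb hxb
  simp only [indicator_of_mem hxa, indicator_of_mem hya]
  by_cases hy : φ y = ∞
  · simp [hy, ENNReal.top_sub hκ, ENNReal.mul_top, Real.exp_pos]
  have hx : φ x ≠ ∞ := ne_top_of_le_ne_top (by finiteness) (hφ hxy)
  lift κ to ℝ≥0 using hκ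
  have hu : (φ x).toReal ≤ Real.exp (A' * symbolicDist T P θ x y) * (φ y).toReal := by
    simpa [(Real.exp_pos _).le] using ENNReal.toReal_mono (by finiteness) (hφ hxy)
  have hκy : (κ : ℝ) * (A * Real.exp A) ≤ (A - A') * (φ y).toReal := by
    simpa [(hA'.trans hA.le), (sub_pos.2 hA).le, (Real.exp_pos A).le, mul_nonneg] using
      ENNReal.toReal_mono (by finiteness) (hκφ y hya)
  rw [← ENNReal.ofReal_toReal hx, ← ENNReal.ofReal_toReal hy, ← ENNReal.ofReal_coe_nnreal,
    ← ENNReal.ofReal_sub _ κ.coe_nonneg, ← ENNReal.ofReal_sub _ κ.coe_nonneg,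
    ← ENNReal.ofReal_mul (Real.exp_pos _).le]
  exact ENNReal.ofReal_le_ofReal (sub_le_exp_mul_sub hA' hA ht ht1 hu κ.coe_nonneg hκy)

variable [MeasurableSpace X] {μ : Measure X}

theorem MemCone.exists_eq_add_indicator (hφ : MemCone T μ P θ A' φ) (hP : Setoid.IsPartition P)
    (hθ : 0 ≤ θ) (hθ1 : θ ≤ 1) (hA' : 0 ≤ A') (hA : A' < A) {b : Set X} (hb : b ∈ P)
    (hmb : MeasurableSet b) {κ : ℝ≥0∞} (hκ : κ ≠ ∞)
    (hκφ : ∀ x ∈ b, κ * ENNReal.ofReal (A * Real.exp A) ≤ ENNReal.ofReal (A - A') * φ x) :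
    ∃ φ', MemCone T μ P θ A φ' ∧ φ = φ' + b.indicator fun _ => κ := by
  have hle : b.indicator (fun _ => κ) ≤ φ := fun x =>
    indicator_apply_le' (fun hx => le_of_mul_ofReal_mul_exp_le hA' hA (hκφ x hx)) fun _ => zero_le
  exact ⟨fun x => φ x - b.indicator (fun _ => κ) x,
    { measurable := hφ.measurable.sub (measurable_const.indicator hmb)
      isLogLipschitz := hφ.isLogLipschitz.sub_indicator hP hθ hθ1 hA' hA hb hκ hκφ
      lintegral_ne_top := ne_top_of_le_ne_top hφ.lintegral_ne_top
        (lintegral_mono fun _ => tsub_le_self) },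
    funext fun x => (tsub_add_cancel_of_le (hle x)).symm⟩

namespace IsGibbsMap

variable (h : IsGibbsMap T μ P θ K δ g)
include h

theorem exists_coupling (hmix : IsMixing T μ) (hA : 0 ≤ A) (hAθ : θ * (K + A) < A) :
    ∃ N : ℕ, ∃ q : ℝ≥0∞, q < 1 ∧ ∃ f : X → ℝ≥0∞, ∀ φ, MemCone T μ P θ A φ →
      ∃ φ', MemCone T μ P θ A φ' ∧ ∫⁻ x, φ' x ∂μ = q * ∫⁻ x, φ x ∂μ ∧
        (branchSum T P g)^[N + 1] φ = φ' + fun x => (∫⁻ x, φ x ∂μ) * f x := by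
  have := h.isProbabilityMeasure
  obtain ⟨N, b, hb, hb0, C, hC, hlow⟩ := h.exists_lintegral_le_iterate hmix hA hAθ.le
  have hmb := h.measurableSet b hb
  set A' := θ * (K + A)
  have hA' : 0 ≤ A' := mul_nonneg h.theta_pos.le (add_nonneg h.nonneg hA)
  obtain ⟨κ, hκ0, hκ, hlow_mul⟩ := exists_mul_mul_le_of_le_mul
    (E := ENNReal.ofReal (A * Real.exp A)) hC
    (ENNReal.ofReal_pos.2 (mul_pos (hA'.trans_lt hAθ) (Real.exp_pos A))).ne' ENNReal.ofReal_ne_top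
    (ENNReal.ofReal_pos.2 (sub_pos.2 hAθ)).ne' ENNReal.ofReal_ne_top
  refine ⟨N, 1 - κ * μ b, ENNReal.sub_lt_self (by simp) one_ne_zero (mul_ne_zero hκ0 hb0),
    b.indicator fun _ => κ, fun φ hφ => ?_⟩
  have hfin := hφ.lintegral_ne_top
  have hcone : MemCone T μ P θ A' ((branchSum T P g)^[N + 1] φ) := by
    rw [Function.iterate_succ_apply']
    exact h.memCone_branchSum (h.memCone_iterate_branchSum hAθ.le hφ N)
  obtain ⟨φ', hφ', heq⟩ := hcone.exists_eq_add_indicator h.isPartition h.theta_pos.le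
    h.theta_lt_one.le hA' hAθ hb hmb (ENNReal.mul_ne_top hfin hκ)
    fun x hx => hlow_mul _ _ (hlow φ hφ x hx)
  have hint : ∫⁻ x, φ x ∂μ = ∫⁻ x, φ' x ∂μ + (∫⁻ x, φ x ∂μ) * κ * μ b :=
    calc ∫⁻ x, φ x ∂μ = ∫⁻ x, (branchSum T P g)^[N + 1] φ x ∂μ :=
          (h.lintegral_iterate_branchSum hφ.measurable _).symm
      _ = ∫⁻ x, φ' x + b.indicator (fun _ => (∫⁻ x, φ x ∂μ) * κ) x ∂μ :=
          lintegral_congr (congrFun heq)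
      _ = _ := by rw [lintegral_add_left hφ'.measurable, lintegral_indicator_const hmb]
  refine ⟨φ', hφ', ?_, heq.trans ?_⟩
  · rw [ENNReal.sub_mul fun _ _ => hfin, one_mul]
    refine ENNReal.eq_sub_of_add_eq (by finiteness) ?_
    conv_rhs => rw [hint]
    ring
  · congr 1
    ext x
    by_cases hx : x ∈ b <;> simp [hx]

theorem exists_iterate_le_add (hmix : IsMixing T μ) (hA : 0 ≤ A) (hAθ : θ * (K + A) < A) :
    ∃ N : ℕ, ∃ q D : ℝ≥0∞, q < 1 ∧ D ≠ ∞ ∧ ∀ (k m : ℕ) (φ ψ : X → ℝ≥0∞),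
      MemCone T μ P θ A φ → MemCone T μ P θ A ψ → ∫⁻ x, φ x ∂μ = ∫⁻ x, ψ x ∂μ →
      ∀ x, (branchSum T P g)^[m + 1 + (N + 1) * k] φ x ≤
        D * (q ^ k * ∫⁻ x, φ x ∂μ) + (branchSum T P g)^[m + 1 + (N + 1) * k] ψ x := by
  obtain ⟨N, q, hq, f, hf⟩ := h.exists_coupling hmix hA hAθ
  refine ⟨N, q, δ⁻¹ * ENNReal.ofReal (Real.exp (K + A)), hq,
    ENNReal.mul_ne_top (ENNReal.inv_ne_top.2 h.delta_pos.ne') ENNReal.ofReal_ne_top,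
    fun k m => ?_⟩
  induction k with
  | zero =>
    intro φ ψ hφ _ _ x
    have hbound := h.branchSum_le hA (h.memCone_iterate_branchSum hAθ.le hφ m) x
    rw [h.lintegral_iterate_branchSum hφ.measurable,
      ← Function.iterate_succ_apply' (branchSum T P g)] at hbound
    simpa using hbound.trans le_self_add
  | succ k ih =>
    intro φ ψ hφ hψ heq x
    obtain ⟨φ', hφ', hφi, hφe⟩ := hf φ hφ
    obtain ⟨ψ', hψ', hψi, hψe⟩ := hf ψ hψ
    rw [Nat.mul_succ, ← add_assoc, Function.iterate_add_apply, hφe,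
      Function.iterate_add_apply _ _ _ ψ, hψe, iterate_branchSum_add, iterate_branchSum_add, heq,
      Pi.add_apply, Pi.add_apply, ← add_assoc]
    gcongr
    refine (ih φ' ψ' hφ' hψ' (by rw [hφi, hψi, heq]) x).trans_eq ?_
    rw [hφi, heq, pow_succ, mul_assoc (q ^ k)]

theorem exists_iterate_le_pow_mul_add (hmix : IsMixing T μ) (hA : 0 ≤ A)
    (hAθ : θ * (K + A) < A) :
    ∃ D ρ : ℝ, 0 ≤ D ∧ 0 < ρ ∧ ρ < 1 ∧ ∀ (n : ℕ) (φ ψ : X → ℝ≥0∞),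
      MemCone T μ P θ A φ → MemCone T μ P θ A ψ → ∫⁻ x, φ x ∂μ = ∫⁻ x, ψ x ∂μ →
      ∀ x, (branchSum T P g)^[n + 1] φ x ≤
        ENNReal.ofReal (D * ρ ^ n) * ∫⁻ x, φ x ∂μ + (branchSum T P g)^[n + 1] ψ x := by
  obtain ⟨N, q, D, hq, hD, hbound⟩ := h.exists_iterate_le_add hmix hA hAθ
  obtain ⟨C, ρ, hC, hρ, hρ1, hpow⟩ := exists_pow_div_le (τ := q.toReal) ENNReal.toReal_nonneg
    (ENNReal.toReal_lt_of_lt_ofReal (by simpa using hq)) (Nat.succ_ne_zero N)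
  refine ⟨D.toReal * C, ρ, by positivity, hρ, hρ1, fun n φ ψ hφ hψ heq x => ?_⟩
  have hn : n % (N + 1) + 1 + (N + 1) * (n / (N + 1)) = n + 1 := by
    have := Nat.mod_add_div n (N + 1)
    omega
  have hrate : D * q ^ (n / (N + 1)) ≤ ENNReal.ofReal (D.toReal * C * ρ ^ n) := by
    rw [← ENNReal.ofReal_toReal hD, ← ENNReal.ofReal_toReal hq.ne_top,
      ← ENNReal.ofReal_pow ENNReal.toReal_nonneg, ← ENNReal.ofReal_mul ENNReal.toReal_nonneg,
      ENNReal.toReal_ofReal ENNReal.toReal_nonneg, mul_assoc]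
    gcongr
    exact hpow n
  refine (hn ▸ hbound (n / (N + 1)) (n % (N + 1)) φ ψ hφ hψ heq x).trans ?_
  rw [← mul_assoc]
  gcongr

theorem exists_abs_iterate_sub_le (hmix : IsMixing T μ) (hA : 0 ≤ A) (hAθ : θ * (K + A) < A) :
    ∃ D ρ : ℝ, 0 ≤ D ∧ 0 < ρ ∧ ρ < 1 ∧ ∀ φ, MemCone T μ P θ A φ → ∀ n : ℕ, ∀ᵐ x ∂μ,
      |((branchSum T P g)^[n + 1] φ x).toReal - (∫⁻ x, φ x ∂μ).toReal| ≤
        D * ρ ^ n * (∫⁻ x, φ x ∂μ).toReal := by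
  have := h.isProbabilityMeasure
  obtain ⟨D, ρ, hD, hρ, hρ1, hbound⟩ := h.exists_iterate_le_pow_mul_add hmix hA hAθ
  refine ⟨D, ρ, hD, hρ, hρ1, fun φ hφ n => ?_⟩
  set I := ∫⁻ x, φ x ∂μ with hI
  have hfin : I ≠ ∞ := hφ.lintegral_ne_top
  have hconst := memCone_const (T := T) (μ := μ) (P := P) h.theta_pos.le hA hfin
  have hint : ∫⁻ _, I ∂μ = I := by simp
  filter_upwards [h.iterate_branchSum_const I (n + 1)] with x hx
  have hle := hbound n φ _ hφ hconst hint.symm x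
  have hge := hbound n _ φ hconst hφ hint x
  rw [hx, ← hI] at hle
  rw [hx, hint] at hge
  have hL : (branchSum T P g)^[n + 1] φ x ≠ ∞ := ne_top_of_le_ne_top (by finiteness) hle
  have hle' := ENNReal.toReal_mono (by finiteness) hle
  have hge' := ENNReal.toReal_mono (by finiteness) hge
  rw [ENNReal.toReal_add (by finiteness) (by finiteness), ENNReal.toReal_mul,
    ENNReal.toReal_ofReal (by positivity)] at hle' hge'
  rw [abs_le]
  constructor <;> linarith

end IsGibbsMap

end Coupling

/-! ### Transfer and Koopman operators on `L^p` -/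

section MeasurePreserving

variable {X Y E : Type*} [MeasurableSpace X] [MeasurableSpace Y] [NormedAddCommGroup E]
  [NormedSpace ℝ E] {T : X → Y} {μ : Measure X} {ν : Measure Y}

theorem setIntegral_preimage_comp (hT : MeasurePreserving T μ ν) {φ : Y → E}
    (hφ : AEStronglyMeasurable φ ν) {A : Set Y} (hA : MeasurableSet A) :
    ∫ x in T ⁻¹' A, φ (T x) ∂μ = ∫ y in A, φ y ∂ν := by
  have := setIntegral_map (μ := μ) (f := φ) hA (by rwa [hT.map_eq]) hT.aemeasurable
  rwa [hT.map_eq, eq_comm] at this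

theorem integral_comp_of_measurePreserving (hT : MeasurePreserving T μ ν) {φ : Y → E}
    (hφ : AEStronglyMeasurable φ ν) : ∫ x, φ (T x) ∂μ = ∫ y, φ y ∂ν := by
  simpa using setIntegral_preimage_comp hT hφ MeasurableSet.univ

end MeasurePreserving

section TransferOperator

variable {X : Type*} [MeasurableSpace X] {T : X → X} {μ : Measure X}

theorem transferOperator_congr {φ ψ : X → ℝ} (h : φ =ᵐ[μ] ψ) :
    transferOperator T μ φ = transferOperator T μ ψ := by
  rw [transferOperator, transferOperator, WithDensityᵥEq.congr_ae h]

variable [IsFiniteMeasure μ]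

theorem transferOperator_ae_eq (hT : MeasurePreserving T μ μ) {φ f : X → ℝ} (hφ : Integrable φ μ)
    (hf : Integrable f μ)
    (h : ∀ A, MeasurableSet A → ∫ x in A, f x ∂μ = ∫ x in T ⁻¹' A, φ x ∂μ) :
    transferOperator T μ φ =ᵐ[μ] f :=
  (integrable_transferOperator T μ φ).ae_eq_of_forall_setIntegral_eq _ _ hf fun A hA _ => by
    rw [setIntegral_transferOperator hT hφ hA, h A hA]

theorem transferOperator_add (hT : MeasurePreserving T μ μ) {φ ψ : X → ℝ} (hφ : Integrable φ μ)
    (hψ : Integrable ψ μ) :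
    transferOperator T μ (φ + ψ) =ᵐ[μ] transferOperator T μ φ + transferOperator T μ ψ := by
  have h1 := integrable_transferOperator T μ φ
  have h2 := integrable_transferOperator T μ ψ
  refine transferOperator_ae_eq hT (hφ.add hψ) (h1.add h2) fun A hA => ?_
  rw [integral_add' h1.integrableOn h2.integrableOn, integral_add' hφ.integrableOn hψ.integrableOn,
    setIntegral_transferOperator hT hφ hA, setIntegral_transferOperator hT hψ hA]

theorem transferOperator_const_smul (hT : MeasurePreserving T μ μ) (c : ℝ) {φ : X → ℝ}
    (hφ : Integrable φ μ) : transferOperator T μ (c • φ) =ᵐ[μ] c • transferOperator T μ φ := by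
  refine transferOperator_ae_eq hT (hφ.smul c)
    ((integrable_transferOperator T μ φ).smul c) fun A hA => ?_
  simp only [Pi.smul_apply, integral_smul, setIntegral_transferOperator hT hφ hA]

theorem transferOperator_const (hT : MeasurePreserving T μ μ) (c : ℝ) :
    transferOperator T μ (fun _ => c) =ᵐ[μ] fun _ => c := by
  refine transferOperator_ae_eq hT (integrable_const c) (integrable_const c) fun A hA => ?_
  rw [setIntegral_const, setIntegral_const, measureReal_def, measureReal_def,
    hT.measure_preimage hA.nullMeasurableSet]

theorem transferOperator_comp_self (hT : MeasurePreserving T μ μ) {φ : X → ℝ}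
    (hφ : Integrable φ μ) : transferOperator T μ (φ ∘ T) =ᵐ[μ] φ :=
  transferOperator_ae_eq hT ((hT.integrable_comp hφ.1).2 hφ) hφ fun _ hA =>
    (setIntegral_preimage_comp hT hφ.1 hA).symm

theorem transferOperator_transferOperator {S : X → X} (hS : MeasurePreserving S μ μ)
    (hT : MeasurePreserving T μ μ) {φ : X → ℝ} (hφ : Integrable φ μ) :
    transferOperator S μ (transferOperator T μ φ) =ᵐ[μ] transferOperator (S ∘ T) μ φ := by
  refine transferOperator_ae_eq hS (integrable_transferOperator T μ φ)
    (integrable_transferOperator (S ∘ T) μ φ) fun A hA => ?_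
  rw [setIntegral_transferOperator (hS.comp hT) hφ hA,
    setIntegral_transferOperator hT hφ (hS.measurable hA), preimage_comp]

theorem transferOperator_comp_ae_eq_condExp (hT : MeasurePreserving T μ μ) {φ : X → ℝ}
    (hφ : Integrable φ μ) :
    transferOperator T μ φ ∘ T =ᵐ[μ] μ[φ | MeasurableSpace.comap T inferInstance] := by
  have hL := integrable_transferOperator T μ φ
  refine ae_eq_condExp_of_forall_setIntegral_eq hT.measurable.comap_le hφ
    (fun s _ _ => ((hT.integrable_comp hL.1).2 hL).integrableOn) ?_ ?_
  · rintro s ⟨A, hA, rfl⟩ -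
    exact (setIntegral_preimage_comp hT hL.1 hA).trans (setIntegral_transferOperator hT hφ hA)
  · exact ((SignedMeasure.measurable_rnDeriv _ _).stronglyMeasurable.comp_measurable
      (comap_measurable T)).aestronglyMeasurable

theorem eLpNorm_transferOperator_le (hT : MeasurePreserving T μ μ) {φ : X → ℝ}
    (hφ : Integrable φ μ) {p : ℝ≥0∞} (hp : 1 ≤ p) :
    eLpNorm (transferOperator T μ φ) p μ ≤ eLpNorm φ p μ :=
  calc eLpNorm (transferOperator T μ φ) p μ = eLpNorm (transferOperator T μ φ ∘ T) p μ :=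
        (eLpNorm_comp_measurePreserving (integrable_transferOperator T μ φ).1 hT).symm
    _ = eLpNorm (μ[φ | MeasurableSpace.comap T inferInstance]) p μ :=
        eLpNorm_congr_ae (transferOperator_comp_ae_eq_condExp hT hφ)
    _ ≤ eLpNorm φ p μ := eLpNorm_condExp_le_eLpNorm φ hp

theorem memLp_transferOperator (hT : MeasurePreserving T μ μ) {φ : X → ℝ} {p : ℝ≥0∞}
    (hp : 1 ≤ p) (hφ : MemLp φ p μ) : MemLp (transferOperator T μ φ) p μ :=
  ⟨(integrable_transferOperator T μ φ).1,
    (eLpNorm_transferOperator_le hT (hφ.integrable hp) hp).trans_lt hφ.2⟩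

end TransferOperator

section Lp

variable {X Y Z : Type*} [MeasurableSpace X] [MeasurableSpace Y] [MeasurableSpace Z]
  {μ : Measure X} {ν : Measure Y} {τ : Measure Z} {p : ℝ≥0∞} [Fact (1 ≤ p)]

/-- The Koopman operator `φ ↦ φ ∘ T` of a measure preserving map, as a continuous linear map
between spaces `L^p`. -/
noncomputable def koopman {T : X → Y} (hT : MeasurePreserving T μ ν) :
    Lp ℝ p ν →L[ℝ] Lp ℝ p μ :=
  (Lp.compMeasurePreservingₗᵢ ℝ T hT).toContinuousLinearMap

theorem coeFn_koopman {T : X → Y} (hT : MeasurePreserving T μ ν) (φ : Lp ℝ p ν) :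
    koopman hT φ =ᵐ[μ] φ ∘ T :=
  Lp.coeFn_compMeasurePreserving φ hT

theorem norm_koopman {T : X → Y} (hT : MeasurePreserving T μ ν) (φ : Lp ℝ p ν) :
    ‖koopman hT φ‖ = ‖φ‖ :=
  Lp.norm_compMeasurePreserving φ hT

theorem koopman_toLp {T : X → Y} (hT : MeasurePreserving T μ ν) {φ : Y → ℝ} (hφ : MemLp φ p ν) :
    koopman hT (hφ.toLp φ) = (hφ.comp_measurePreserving hT).toLp (φ ∘ T) :=
  Lp.toLp_compMeasurePreserving hφ hT

theorem koopman_koopman {T : X → Y} {S : Y → Z} (hS : MeasurePreserving S ν τ)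
    (hT : MeasurePreserving T μ ν) (φ : Lp ℝ p τ) :
    koopman hT (koopman hS φ) = koopman (hS.comp hT) φ :=
  (Lp.compMeasurePreserving_comp_apply φ hS hT).symm

variable [IsProbabilityMeasure μ] {T : X → X}

theorem integrable_coeFn_Lp (φ : Lp ℝ p μ) : Integrable φ μ :=
  (Lp.memLp φ).integrable Fact.out

theorem abs_integral_coeFn_le (φ : Lp ℝ p μ) : |∫ x, φ x ∂μ| ≤ ‖φ‖ := by
  rw [← ENNReal.ofReal_le_ofReal_iff (norm_nonneg φ), Lp.norm_def, ENNReal.ofReal_toReal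
    (Lp.eLpNorm_ne_top φ)]
  calc ENNReal.ofReal |∫ x, φ x ∂μ| ≤ ∫⁻ x, ‖φ x‖ₑ ∂μ := by
        rw [← Real.enorm_eq_ofReal_abs]
        exact enorm_integral_le_lintegral_enorm _
    _ = eLpNorm φ 1 μ := eLpNorm_one_eq_lintegral_enorm.symm
    _ ≤ eLpNorm φ p μ := eLpNorm_le_eLpNorm_of_exponent_le Fact.out (Lp.aestronglyMeasurable φ)

/-- The integral as a continuous linear functional on the space `L^p` of a probability measure. -/
noncomputable def integralLp (p : ℝ≥0∞) [Fact (1 ≤ p)] (μ : Measure X) [IsProbabilityMeasure μ] :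
    Lp ℝ p μ →L[ℝ] ℝ :=
  LinearMap.mkContinuous
    { toFun := fun φ => ∫ x, φ x ∂μ
      map_add' := fun φ ψ => by
        rw [integral_congr_ae (Lp.coeFn_add φ ψ)]
        exact integral_add (integrable_coeFn_Lp φ) (integrable_coeFn_Lp ψ)
      map_smul' := fun c φ => by
        rw [integral_congr_ae (Lp.coeFn_smul c φ)]
        exact integral_smul c φ }
    1 fun φ => by
      rw [one_mul]
      exact abs_integral_coeFn_le φ

theorem integralLp_toLp {φ : X → ℝ} (hφ : MemLp φ p μ) :
    integralLp p μ (hφ.toLp φ) = ∫ x, φ x ∂μ :=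
  integral_congr_ae hφ.coeFn_toLp

theorem norm_sub_const_integralLp_le (φ : Lp ℝ p μ) :
    ‖φ - Lp.const p μ (integralLp p μ φ)‖ ≤ 2 * ‖φ‖ := by
  have hconst : ‖Lp.const p μ (integralLp p μ φ)‖ ≤ ‖φ‖ := by
    refine (Lp.norm_const_le _ _ _).trans ?_
    rw [probReal_univ, Real.one_rpow, mul_one]
    exact abs_integral_coeFn_le φ
  linarith [norm_sub_le φ (Lp.const p μ (integralLp p μ φ))]

theorem integralLp_koopman [IsProbabilityMeasure ν] {T : X → Y} (hT : MeasurePreserving T μ ν)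
    (φ : Lp ℝ p ν) : integralLp p μ (koopman hT φ) = integralLp p ν φ :=
  (integral_congr_ae (coeFn_koopman hT φ)).trans
    (integral_comp_of_measurePreserving hT (Lp.aestronglyMeasurable φ))

/-- The transfer operator of a measure preserving map on `L^p`, a continuous linear map of norm at
most `1`. -/
noncomputable def transferLp (hT : MeasurePreserving T μ μ) : Lp ℝ p μ →L[ℝ] Lp ℝ p μ :=
  LinearMap.mkContinuous
    { toFun := fun φ => (memLp_transferOperator hT Fact.out (Lp.memLp φ)).toLp
      map_add' := fun φ ψ => by
        rw [← MemLp.toLp_add, MemLp.toLp_eq_toLp_iff, transferOperator_congr (Lp.coeFn_add φ ψ)]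
        exact transferOperator_add hT (integrable_coeFn_Lp φ) (integrable_coeFn_Lp ψ)
      map_smul' := fun c φ => by
        rw [RingHom.id_apply, ← MemLp.toLp_const_smul, MemLp.toLp_eq_toLp_iff,
          transferOperator_congr (Lp.coeFn_smul c φ)]
        exact transferOperator_const_smul hT c (integrable_coeFn_Lp φ) }
    1 fun φ => by
      rw [one_mul, Lp.norm_def φ]
      exact (Lp.norm_toLp _ (memLp_transferOperator hT Fact.out (Lp.memLp φ))).trans_le <|
        ENNReal.toReal_mono (Lp.eLpNorm_ne_top φ)
          (eLpNorm_transferOperator_le hT (integrable_coeFn_Lp φ) Fact.out)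

theorem coeFn_transferLp (hT : MeasurePreserving T μ μ) (φ : Lp ℝ p μ) :
    transferLp hT φ =ᵐ[μ] transferOperator T μ φ :=
  (memLp_transferOperator hT Fact.out (Lp.memLp φ)).coeFn_toLp

theorem transferLp_koopman (hT : MeasurePreserving T μ μ) (φ : Lp ℝ p μ) :
    transferLp hT (koopman hT φ) = φ := by
  refine Lp.ext ((coeFn_transferLp hT _).trans ?_)
  rw [transferOperator_congr (coeFn_koopman hT φ)]
  exact transferOperator_comp_self hT (integrable_coeFn_Lp φ)

theorem norm_transferLp_pow_le (hT : MeasurePreserving T μ μ) (n : ℕ) (φ : Lp ℝ p μ) :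
    ‖(transferLp hT ^ n) φ‖ ≤ ‖φ‖ := by
  have h1 : ‖transferLp (p := p) hT‖ ≤ 1 := LinearMap.mkContinuous_norm_le _ zero_le_one _
  refine ((transferLp hT ^ n).le_of_opNorm_le ?_ φ).trans_eq (one_mul _)
  induction n with
  | zero => exact ContinuousLinearMap.norm_id_le
  | succ n ih =>
    exact (ContinuousLinearMap.opNorm_comp_le _ _).trans (mul_le_one₀ ih (norm_nonneg _) h1)

theorem coeFn_transferLp_pow_toLp (hT : MeasurePreserving T μ μ) {φ : X → ℝ} (hφ : MemLp φ p μ)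
    (n : ℕ) : (transferLp hT ^ n) (hφ.toLp φ) =ᵐ[μ] transferOperator T^[n] μ φ := by
  have hφi := hφ.integrable Fact.out
  induction n with
  | zero =>
    exact hφ.coeFn_toLp.trans (transferOperator_comp_self (MeasurePreserving.id μ) hφi).symm
  | succ n ih =>
    rw [pow_succ', Function.iterate_succ']
    refine (coeFn_transferLp hT ((transferLp hT ^ n) (hφ.toLp φ))).trans ?_
    rw [transferOperator_congr ih]
    exact transferOperator_transferOperator hT (hT.iterate n) hφi

end Lp

/-! ### Decay of the transfer operator on observables controlled at a later time -/

section Decay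

variable {X : Type*} {T : X → X} {P : Set (Set X)} {θ K B : ℝ} {r U : X → ℝ} {j : ℕ}

theorem apply_iterate_eq_of_lt_separationTime (hrP : ∀ a ∈ P, ∀ x ∈ a, ∀ y ∈ a, r x = r y)
    {x y : X} (hxy : (j : ℕ∞) < separationTime T P x y) : r (T^[j] x) = r (T^[j] y) := by
  obtain ⟨a, ha, hx, hy⟩ := natCast_le_separationTime.1 (Order.add_one_le_of_lt hxy) j (by simp)
  exact hrP a ha _ hx _ hy

theorem isLogLipschitz_ofReal_comp_iterate (hθ : 0 ≤ θ)
    (hrP : ∀ a ∈ P, ∀ x ∈ a, ∀ y ∈ a, r x = r y) {A : ℝ} (hA : 0 ≤ A) (j : ℕ) :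
    IsLogLipschitz T P θ j A fun x => ENNReal.ofReal (r (T^[j] x)) := by
  intro x y hxy
  beta_reduce
  rw [apply_iterate_eq_of_lt_separationTime hrP hxy]
  exact le_mul_of_one_le_left zero_le <| ENNReal.one_le_ofReal.2 <|
    Real.one_le_exp (mul_nonneg hA (symbolicDist_nonneg hθ x y))

variable [MeasurableSpace X]

/-- The observable `U` and its Lipschitz constants for `d_θ` on the cylinders of length `j + 1`
are bounded in terms of the weight `r` at time `j`. Uniformly in `j`, the former are exponentially
small while the latter may be exponentially large. -/
structure IsControlled (T : X → X) (P : Set (Set X)) (θ B : ℝ) (r : X → ℝ) (j : ℕ)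
    (U : X → ℝ) : Prop where
  measurable : Measurable U
  abs_le : ∀ x, |U x| ≤ B * θ ^ j * r (T^[j] x)
  abs_sub_le : ∀ x y, (j : ℕ∞) < separationTime T P x y →
    |U x - U y| ≤ B * r (T^[j] y) * (θ⁻¹ ^ j * symbolicDist T P θ x y)

namespace IsControlled

theorem abs_le_mul (hU : IsControlled T P θ B r j U) (hθ : 0 ≤ θ) (hθ1 : θ ≤ 1) (hB : 0 ≤ B)
    (hr0 : ∀ x, 0 ≤ r x) (x : X) : |U x| ≤ B * r (T^[j] x) := by
  refine (hU.abs_le x).trans ?_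
  rw [mul_right_comm]
  exact mul_le_of_le_one_right (mul_nonneg hB (hr0 _)) (pow_le_one₀ hθ hθ1)

theorem isLogLipschitz_ofReal_add (hU : IsControlled T P θ B r j U) (hθ : 0 ≤ θ) (hθ1 : θ ≤ 1)
    (hB : 0 ≤ B) (hr0 : ∀ x, 0 ≤ r x) (hrP : ∀ a ∈ P, ∀ x ∈ a, ∀ y ∈ a, r x = r y) :
    IsLogLipschitz T P θ j (θ⁻¹ ^ j) fun x => ENNReal.ofReal (U x + 2 * B * r (T^[j] x)) := by
  intro x y hxy
  have hUy := neg_le_of_abs_le (hU.abs_le_mul hθ hθ1 hB hr0 y)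
  set w := r (T^[j] y) with hw
  set e := θ⁻¹ ^ j * symbolicDist T P θ x y
  have he0 : 0 ≤ e := mul_nonneg (by positivity) (symbolicDist_nonneg hθ x y)
  have hw0 : 0 ≤ B * w := mul_nonneg hB (hr0 _)
  beta_reduce
  rw [apply_iterate_eq_of_lt_separationTime hrP hxy, ← hw,
    ← ENNReal.ofReal_mul (Real.exp_pos _).le]
  refine ENNReal.ofReal_le_ofReal ?_
  calc U x + 2 * B * w ≤ (U y + 2 * B * w) + B * w * e := by
        linarith [(le_abs_self _).trans (hU.abs_sub_le x y hxy)]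
    _ ≤ (U y + 2 * B * w) + (U y + 2 * B * w) * e := by gcongr; linarith
    _ = (e + 1) * (U y + 2 * B * w) := by ring
    _ ≤ Real.exp e * (U y + 2 * B * w) := by
        gcongr
        · linarith
        · exact Real.add_one_le_exp e

variable {μ : Measure X} {p : ℝ≥0∞}

theorem memLp (hU : IsControlled T P θ B r j U) (hT : MeasurePreserving T μ μ)
    (hr : MemLp r p μ) : MemLp U p μ :=
  ((hr.comp_measurePreserving (hT.iterate j)).const_mul (B * θ ^ j)).mono'
    hU.measurable.aestronglyMeasurable (.of_forall hU.abs_le)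

theorem norm_toLp_le (hU : IsControlled T P θ B r j U) [Fact (1 ≤ p)]
    (hT : MeasurePreserving T μ μ) (hθ : 0 ≤ θ) (hB : 0 ≤ B) (hr : MemLp r p μ) :
    ‖(hU.memLp hT hr).toLp U‖ ≤ B * θ ^ j * ‖hr.toLp r‖ := by
  rw [← norm_koopman (hT.iterate j) (hr.toLp r), koopman_toLp]
  refine Lp.norm_le_mul_norm_of_ae_le_mul ?_
  filter_upwards [(hU.memLp hT hr).coeFn_toLp,
    (hr.comp_measurePreserving (hT.iterate j)).coeFn_toLp] with x hUx hrx
  rw [hUx, hrx, Real.norm_eq_abs]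
  refine (hU.abs_le x).trans ?_
  gcongr
  exact Real.le_norm_self _

theorem integral_le (hU : IsControlled T P θ B r j U) (hT : MeasurePreserving T μ μ)
    (hr : Integrable r μ) (hθ : 0 ≤ θ) (hθ1 : θ ≤ 1) (hB : 0 ≤ B) (hr0 : ∀ x, 0 ≤ r x) :
    ∫ x, U x ∂μ ≤ B * ∫ x, r x ∂μ := by
  have hU1 := hU.memLp hT (memLp_one_iff_integrable.2 hr)
  rw [← integral_comp_of_measurePreserving (hT.iterate j) hr.1, ← integral_const_mul]
  exact integral_mono (memLp_one_iff_integrable.1 hU1)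
    ((((hT.iterate j).integrable_comp hr.1).2 hr).const_mul _)
    fun x => (le_abs_self _).trans (hU.abs_le_mul hθ hθ1 hB hr0 x)

end IsControlled

theorem abs_transferOperator_sub_integral_le_of_add {μ : Measure X} [IsFiniteMeasure μ]
    (hT : MeasurePreserving T μ μ) {φ ψ : X → ℝ} (hφ : Integrable φ μ) (hψ : Integrable ψ μ)
    {a b : ℝ} (ha : ∀ᵐ x ∂μ, |transferOperator T μ ψ x - ∫ y, ψ y ∂μ| ≤ a)
    (hb : ∀ᵐ x ∂μ, |transferOperator T μ (φ + ψ) x - ∫ y, (φ + ψ) y ∂μ| ≤ b) :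
    ∀ᵐ x ∂μ, |transferOperator T μ φ x - ∫ y, φ y ∂μ| ≤ b + a := by
  filter_upwards [transferOperator_add hT hφ hψ, ha, hb] with x hadd hax hbx
  rw [hadd, integral_add' hφ hψ, Pi.add_apply, add_sub_add_comm] at hbx
  rw [abs_le] at hax hbx ⊢
  constructor <;> linarith

namespace IsGibbsMap

variable {μ : Measure X} {δ : ℝ≥0∞} {g : X → ℝ≥0∞}
  (h : IsGibbsMap T μ P θ K δ g)
include h

theorem transferOperator_iterate_toReal {φ : X → ℝ≥0∞} (hφ : Measurable φ)
    (hφ' : ∫⁻ x, φ x ∂μ ≠ ∞) (n : ℕ) :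
    transferOperator T^[n] μ (fun x => (φ x).toReal) =ᵐ[μ]
      fun x => ((branchSum T P g)^[n] φ x).toReal := by
  have := h.isProbabilityMeasure
  have hL := h.measurable_iterate_branchSum hφ n
  have hL' : ∫⁻ x, (branchSum T P g)^[n] φ x ∂μ ≠ ∞ := by
    rwa [h.lintegral_iterate_branchSum hφ]
  refine transferOperator_ae_eq (h.measurePreserving.iterate n)
    (integrable_toReal_of_lintegral_ne_top hφ.aemeasurable hφ')
    (integrable_toReal_of_lintegral_ne_top hL.aemeasurable hL') fun A hA => ?_
  rw [integral_toReal hL.aemeasurable (ae_restrict_of_ae (ae_lt_top hL hL')),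
    integral_toReal hφ.aemeasurable (ae_restrict_of_ae (ae_lt_top hφ hφ')),
    h.setLIntegral_iterate_branchSum hφ n hA]

theorem exists_abs_transferOperator_sub_le (hmix : IsMixing T μ) :
    ∃ D ρ : ℝ, 0 ≤ D ∧ 0 < ρ ∧ ρ < 1 ∧ ∀ (j : ℕ) (φ : X → ℝ), Measurable φ → Integrable φ μ →
      (∀ x, 0 ≤ φ x) → IsLogLipschitz T P θ j (θ⁻¹ ^ j) (fun x => ENNReal.ofReal (φ x)) →
      ∀ m : ℕ, ∀ᵐ x ∂μ, |transferOperator T^[j + m + 1] μ φ x - ∫ y, φ y ∂μ| ≤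
        D * ρ ^ m * ∫ y, φ y ∂μ := by
  have hθ := h.theta_pos
  have hθ1 : 0 < 1 - θ := sub_pos.2 h.theta_lt_one
  have hA : 0 ≤ θ * K / (1 - θ) := div_nonneg (mul_nonneg hθ.le h.nonneg) hθ1.le
  -- the constant that `j` applications of the transfer operator produce from `θ⁻¹ ^ j`
  have hAθ : θ * (K + (1 + θ * K / (1 - θ))) < 1 + θ * K / (1 - θ) := by
    have : θ * (K + θ * K / (1 - θ)) = θ * K / (1 - θ) := by field
    linarith
  obtain ⟨D, ρ, hD, hρ, hρ1, hbound⟩ := h.exists_abs_iterate_sub_le hmix (by linarith) hAθ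
  refine ⟨D, ρ, hD, hρ, hρ1, fun j φ hφ hφi hφ0 hlip m => ?_⟩
  have hint : ∫⁻ x, ENNReal.ofReal (φ x) ∂μ = ENNReal.ofReal (∫ x, φ x ∂μ) :=
    (ofReal_integral_eq_lintegral_ofReal hφi (.of_forall hφ0)).symm
  have hfin : ∫⁻ x, ENNReal.ofReal (φ x) ∂μ ≠ ∞ := by
    rw [hint]
    finiteness
  have hcone : MemCone T μ P θ (1 + θ * K / (1 - θ))
      ((branchSum T P g)^[j] fun x => ENNReal.ofReal (φ x)) :=
    { measurable := h.measurable_iterate_branchSum hφ.ennreal_ofReal j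
      isLogLipschitz := h.isLogLipschitz_iterate_branchSum (hlip.mono hθ.le (by linarith))
      lintegral_ne_top := by rwa [h.lintegral_iterate_branchSum hφ.ennreal_ofReal] }
  have hL := h.transferOperator_iterate_toReal hφ.ennreal_ofReal hfin (j + m + 1)
  simp only [ENNReal.toReal_ofReal (hφ0 _)] at hL
  filter_upwards [hbound _ hcone m, hL] with x hx hLx
  rwa [← Function.iterate_add_apply, show m + 1 + j = j + m + 1 by ring, ← hLx,
    h.lintegral_iterate_branchSum hφ.ennreal_ofReal, hint,
    ENNReal.toReal_ofReal (integral_nonneg hφ0)] at hx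

theorem exists_abs_transferOperator_sub_le_of_isControlled (hmix : IsMixing T μ) (hB : 0 ≤ B)
    (hr : Measurable r) (hri : Integrable r μ) (hr0 : ∀ x, 0 ≤ r x)
    (hrP : ∀ a ∈ P, ∀ x ∈ a, ∀ y ∈ a, r x = r y) :
    ∃ D ρ : ℝ, 0 ≤ D ∧ 0 < ρ ∧ ρ < 1 ∧ ∀ j U, IsControlled T P θ B r j U → ∀ m : ℕ, ∀ᵐ x ∂μ,
      |transferOperator T^[j + m + 1] μ U x - ∫ y, U y ∂μ| ≤ D * ρ ^ m := by
  have := h.isProbabilityMeasure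
  have hT := h.measurePreserving
  have hθ := h.theta_pos.le
  have hθ1 := h.theta_lt_one.le
  obtain ⟨D, ρ, hD, hρ, hρ1, hbound⟩ := h.exists_abs_transferOperator_sub_le hmix
  have hR : 0 ≤ ∫ x, r x ∂μ := integral_nonneg hr0
  refine ⟨D * (5 * B * ∫ x, r x ∂μ), ρ, by positivity, hρ, hρ1, fun j U hU m => ?_⟩
  have hUi := (hU.memLp hT (memLp_one_iff_integrable.2 hri)).integrable le_rfl
  set ψ : X → ℝ := fun x => 2 * B * r (T^[j] x)
  have hψm : Measurable ψ := (hr.comp (hT.iterate j).measurable).const_mul _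
  have hψi : Integrable ψ μ := (((hT.iterate j).integrable_comp hri.1).2 hri).const_mul _
  have hψ : ∫ x, ψ x ∂μ = 2 * B * ∫ x, r x ∂μ := by
    rw [integral_const_mul, integral_comp_of_measurePreserving (hT.iterate j) hri.1]
  have hψ0 : ∀ x, 0 ≤ ψ x := fun x => mul_nonneg (by positivity) (hr0 _)
  have hψlip : IsLogLipschitz T P θ j (θ⁻¹ ^ j) fun x => ENNReal.ofReal (ψ x) :=
    isLogLipschitz_ofReal_comp_iterate (r := fun x => 2 * B * r x) hθ
      (fun a ha x hx y hy => by rw [hrP a ha x hx y hy]) (by positivity) j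
  have hUψ0 : ∀ x, 0 ≤ (U + ψ) x := fun x => by
    have := neg_le_of_abs_le (hU.abs_le_mul hθ hθ1 hB hr0 x)
    have := hψ0 x
    simp only [Pi.add_apply, ψ] at *
    linarith
  have hUψ : ∫ x, (U + ψ) x ∂μ ≤ 3 * B * ∫ x, r x ∂μ := by
    rw [integral_add' hUi hψi, hψ]
    linarith [hU.integral_le hT hri hθ hθ1 hB hr0]
  filter_upwards [abs_transferOperator_sub_integral_le_of_add (hT.iterate _) hUi hψi
    (hbound j ψ hψm hψi hψ0 hψlip m) (hbound j (U + ψ) (hU.measurable.add hψm) (hUi.add hψi) hUψ0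
      (hU.isLogLipschitz_ofReal_add hθ hθ1 hB hr0 hrP) m)] with x hx
  calc _ ≤ D * ρ ^ m * ∫ x, (U + ψ) x ∂μ + D * ρ ^ m * ∫ x, ψ x ∂μ := hx
    _ ≤ D * ρ ^ m * (3 * B * ∫ x, r x ∂μ) + D * ρ ^ m * (2 * B * ∫ x, r x ∂μ) := by
        rw [hψ]
        gcongr
    _ = D * (5 * B * ∫ x, r x ∂μ) * ρ ^ m := by ring

variable {p : ℝ≥0∞} [Fact (1 ≤ p)] [IsProbabilityMeasure μ]

theorem norm_transferLp_pow_le_of_ae_le (hU : IsControlled T P θ B r j U) (hr : MemLp r p μ)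
    {n : ℕ} {c : ℝ} (hc : 0 ≤ c)
    (hle : ∀ᵐ x ∂μ, |transferOperator T^[n] μ U x - ∫ y, U y ∂μ| ≤ c) :
    ‖(transferLp h.measurePreserving ^ n)
      ((hU.memLp h.measurePreserving hr).toLp U - Lp.const p μ (∫ x, U x ∂μ))‖ ≤ c := by
  have hT := h.measurePreserving
  have hconst : MemLp (fun _ => ∫ x, U x ∂μ) p μ := memLp_const _
  refine (Lp.norm_le_of_ae_bound hc ?_).trans_eq (by simp [measureUnivNNReal])
  rw [show Lp.const p μ (∫ x, U x ∂μ) = hconst.toLp _ from rfl, map_sub]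
  filter_upwards [hle, coeFn_transferLp_pow_toLp hT (hU.memLp hT hr) n,
    coeFn_transferLp_pow_toLp hT hconst n, transferOperator_const (hT.iterate n) (∫ x, U x ∂μ),
    Lp.coeFn_sub ((transferLp hT ^ n) ((hU.memLp hT hr).toLp U))
      ((transferLp hT ^ n) (hconst.toLp _))] with x hx hxU hxc hc hsub
  rwa [hsub, Pi.sub_apply, hxU, hxc, hc, Real.norm_eq_abs]

theorem norm_transferLp_pow_le_of_isControlled (hB : 0 ≤ B) (hU : IsControlled T P θ B r j U)
    (hr : MemLp r p μ) (n : ℕ) :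
    ‖(transferLp h.measurePreserving ^ n)
      ((hU.memLp h.measurePreserving hr).toLp U - Lp.const p μ (∫ x, U x ∂μ))‖ ≤
      2 * (B * θ ^ j * ‖hr.toLp r‖) := by
  have hT := h.measurePreserving
  rw [← integralLp_toLp (hU.memLp hT hr)]
  exact ((norm_transferLp_pow_le hT n _).trans (norm_sub_const_integralLp_le _)).trans
    (mul_le_mul_of_nonneg_left (hU.norm_toLp_le hT h.theta_pos.le hB hr) zero_le_two)

/-- For `n ≤ 2 j` the size `B θ ^ j` of `U` is already small enough; for `n > 2 j` the first `j`
applications of the transfer operator make `U` regular, and the others let it decay. -/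
theorem exists_norm_transferLp_pow_le (hmix : IsMixing T μ) (hB : 0 ≤ B) (hrm : Measurable r)
    (hr : MemLp r p μ) (hr0 : ∀ x, 0 ≤ r x) (hrP : ∀ a ∈ P, ∀ x ∈ a, ∀ y ∈ a, r x = r y) :
    ∃ C ν : ℝ, 0 ≤ C ∧ 0 < ν ∧ ν < 1 ∧ ∀ j U (hU : IsControlled T P θ B r j U) (n : ℕ),
      ‖(transferLp h.measurePreserving ^ n)
        ((hU.memLp h.measurePreserving hr).toLp U - Lp.const p μ (∫ x, U x ∂μ))‖ ≤
      C * ν ^ (n + j) := by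
  obtain ⟨D, ρ, hD, hρ, hρ1, hbound⟩ := h.exists_abs_transferOperator_sub_le_of_isControlled
    hmix hB hrm (hr.integrable Fact.out) hr0 hrP
  obtain ⟨C, ν, hC, hν, hν1, hpow⟩ := exists_pow_div_le (le_max_of_le_left h.theta_pos.le)
    (max_lt h.theta_lt_one hρ1) three_ne_zero
  refine ⟨(2 * B * ‖hr.toLp r‖ + D) * C, ν, by positivity, hν, hν1, fun j U hU n => ?_⟩
  have hT := h.measurePreserving
  set φ := (hU.memLp hT hr).toLp U
  have hτ1 : max θ ρ ≤ 1 := max_le h.theta_lt_one.le hρ1.le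
  have hτ0 : 0 ≤ max θ ρ := le_max_of_le_right hρ.le
  suffices hτ : ‖(transferLp hT ^ n) (φ - Lp.const p μ (∫ x, U x ∂μ))‖ ≤
      (2 * B * ‖hr.toLp r‖ + D) * max θ ρ ^ ((n + j) / 3) from
    (hτ.trans (mul_le_mul_of_nonneg_left (hpow (n + j)) (by positivity))).trans_eq (by ring)
  rcases le_or_gt n (2 * j) with hn | hn
  · calc ‖(transferLp hT ^ n) (φ - Lp.const p μ (∫ x, U x ∂μ))‖
        ≤ 2 * (B * θ ^ j * ‖hr.toLp r‖) := h.norm_transferLp_pow_le_of_isControlled hB hU hr n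
      _ = 2 * B * ‖hr.toLp r‖ * θ ^ j := by ring
      _ ≤ (2 * B * ‖hr.toLp r‖ + D) * max θ ρ ^ j := by
          have := h.theta_pos
          gcongr
          · exact le_add_of_nonneg_right hD
          · exact le_max_left _ _
      _ ≤ _ := by gcongr _ * ?_; exact pow_le_pow_of_le_one hτ0 hτ1 (by lia)
  · obtain ⟨m, rfl⟩ := Nat.exists_eq_add_of_lt (show j < n by lia)
    refine (h.norm_transferLp_pow_le_of_ae_le hU hr (by positivity) (hbound j U hU m)).trans ?_
    gcongr ?_ * ?_
    · exact le_add_of_nonneg_left (by positivity)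
    · exact (pow_le_pow_left₀ hρ.le (le_max_right θ ρ) m).trans
        (pow_le_pow_of_le_one hτ0 hτ1 (by lia))

end IsGibbsMap

end Decay

/-! ### Martingale-coboundary decomposition in a Banach space -/

section Gordin

variable {𝕜 E : Type*} [NontriviallyNormedField 𝕜] [NormedAddCommGroup E] [NormedSpace 𝕜 E]
  {L κ : E →L[𝕜] E}

theorem exists_eq_add_sub_of_summable_pow (hLκ : ∀ x, L (κ x) = x) {w : E}
    (hw : Summable fun n => (L ^ n) w) : ∃ m χ, w = m + κ χ - χ ∧ L m = 0 := by
  have hw' : Summable fun n => (L ^ (n + 1)) w := (summable_nat_add_iff 1).2 hw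
  set χ := ∑' n, (L ^ (n + 1)) w with hχ
  have hLχ : χ = L w + L χ := by
    have hshift (n : ℕ) : (L ^ (n + 1 + 1)) w = L ((L ^ (n + 1)) w) := by
      rw [pow_succ']
      rfl
    rw [hχ, L.map_tsum hw', hw'.tsum_eq_zero_add]
    simp only [hshift, zero_add, pow_one]
  refine ⟨w - κ χ + χ, χ, by abel, ?_⟩
  rw [map_add, map_sub, hLκ, sub_add_eq_add_sub, ← hLχ, sub_self]

theorem summable_pow_apply_of_hasSum [CompleteSpace E] {w : ℕ → E} {s : E} {C ν : ℝ}
    (hν : 0 ≤ ν) (hν1 : ν < 1) (hw : ∀ j n, ‖(L ^ n) (w j)‖ ≤ C * ν ^ (n + j)) (hs : HasSum w s) :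
    Summable fun n => (L ^ n) s := by
  refine .of_norm_bounded ((summable_geometric_of_lt_one hν hν1).mul_left (C * (1 - ν)⁻¹))
    fun n => ?_
  have hgeom : HasSum (fun j => C * ν ^ (n + j)) (C * (1 - ν)⁻¹ * ν ^ n) := by
    simp only [pow_add, ← mul_assoc]
    rw [mul_right_comm]
    exact (hasSum_geometric_of_lt_one hν hν1).mul_left _
  rw [← (hs.mapL (L ^ n)).tsum_eq]
  exact tsum_of_norm_bounded hgeom fun j => hw j n

end Gordin

/-! ### The quotient along stable leaves -/

namespace InducingScheme

section Quotient

variable {M : Type*} [MeasurableSpace M] {S : InducingScheme M}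

theorem r_eq_of_stable {y y' : S.Y} (h : S.stable y y') : S.r y = S.r y' := by
  obtain ⟨a, ⟨ha, hy⟩, -⟩ := S.parts_isPartition.2 y
  exact S.r_const a ha y hy y' (S.stable_subset a ha y hy y' h)

theorem proj_eq_iff {y y' : S.Y} : S.proj y = S.proj y' ↔ S.stable y y' :=
  Quotient.eq (r := S.stable)

theorem Fbar_proj (h : S.PreservesLeaves) (y : S.Y) : S.Fbar h (S.proj y) = S.proj (S.F y) := rfl

theorem iterate_Fbar_proj (h : S.PreservesLeaves) (n : ℕ) (y : S.Y) :
    (S.Fbar h)^[n] (S.proj y) = S.proj (S.F^[n] y) := by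
  have hsemi : Function.Semiconj S.proj S.F (S.Fbar h) := fun _ => rfl
  exact (hsemi.iterate_right n y).symm

theorem stable_iterate (h : S.PreservesLeaves) {y y' : S.Y} (hy : S.stable y y') (n : ℕ) :
    S.stable (S.F^[n] y) (S.F^[n] y') := by
  rw [← proj_eq_iff, ← iterate_Fbar_proj h, ← iterate_Fbar_proj h, proj_eq_iff.2 hy]

theorem exists_mem_alpha_iff {y y' : S.Y} :
    (∃ a ∈ S.alpha, S.proj y ∈ a ∧ S.proj y' ∈ a) ↔ ∃ a ∈ S.parts, y ∈ a ∧ y' ∈ a := by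
  constructor
  · rintro ⟨_, ⟨a, ha, rfl⟩, ⟨z, hz, hzy⟩, ⟨z', hz', hzy'⟩⟩
    exact ⟨a, ha, S.stable_subset a ha z hz y (proj_eq_iff.1 hzy),
      S.stable_subset a ha z' hz' y' (proj_eq_iff.1 hzy')⟩
  · rintro ⟨a, ha, hy, hy'⟩
    exact ⟨_, ⟨a, ha, rfl⟩, ⟨y, hy, rfl⟩, ⟨y', hy', rfl⟩⟩

theorem separationTime_proj (h : S.PreservesLeaves) (y y' : S.Y) :
    separationTime (S.Fbar h) S.alpha (S.proj y) (S.proj y') =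
      separationTime S.F S.parts y y' := by
  refine ENat.eq_of_forall_natCast_le_iff fun n => ?_
  simp only [natCast_le_separationTime, iterate_Fbar_proj, exists_mem_alpha_iff]

variable (S)

/-- The section of the projection `π` with values in the unstable leaf `W^u`. -/
noncomputable def leafPoint (x : S.Ybar) : S.Y := (S.unstable_existsUnique x.out).choose

/-- The inducing time `r` as a real function on the quotient `Ȳ`. -/
noncomputable def rbar (x : S.Ybar) : ℝ := S.r (S.leafPoint x)

variable {S}

theorem leafPoint_mem (x : S.Ybar) : S.leafPoint x ∈ S.unstable :=
  (S.unstable_existsUnique x.out).choose_spec.1.1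

theorem proj_leafPoint (x : S.Ybar) : S.proj (S.leafPoint x) = x := by
  have h := (S.unstable_existsUnique x.out).choose_spec.1.2
  exact (proj_eq_iff.2 h).symm.trans (Quotient.out_eq x)

theorem stable_leafPoint_proj (y : S.Y) : S.stable (S.leafPoint (S.proj y)) y :=
  proj_eq_iff.1 (proj_leafPoint _)

theorem leafPoint_proj {y : S.Y} (hy : y ∈ S.unstable) : S.leafPoint (S.proj y) = y :=
  (S.unstable_existsUnique y).unique
    ⟨leafPoint_mem _, Setoid.symm' _ (stable_leafPoint_proj y)⟩ ⟨hy, Setoid.refl' _ y⟩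

theorem injOn_proj : InjOn S.proj S.unstable := fun y hy y' hy' h => by
  rw [← leafPoint_proj hy, h, leafPoint_proj hy']

theorem stable_F_leafPoint (h : S.PreservesLeaves) (x : S.Ybar) :
    S.stable (S.F (S.leafPoint x)) (S.leafPoint (S.Fbar h x)) := by
  rw [← proj_eq_iff, proj_leafPoint, ← Fbar_proj h, proj_leafPoint]

theorem rbar_nonneg (x : S.Ybar) : 0 ≤ S.rbar x :=
  Nat.cast_nonneg _

theorem rbar_proj (y : S.Y) : S.rbar (S.proj y) = S.r y := by
  rw [rbar, r_eq_of_stable (stable_leafPoint_proj y)]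

theorem rbar_iterate_Fbar (h : S.PreservesLeaves) (j : ℕ) (x : S.Ybar) :
    S.rbar ((S.Fbar h)^[j] x) = S.r (S.F^[j] (S.leafPoint x)) := by
  conv_lhs => rw [← proj_leafPoint x, iterate_Fbar_proj, rbar_proj]

theorem rbar_eq_of_mem_alpha {a : Set S.Ybar} (ha : a ∈ S.alpha) {x x' : S.Ybar} (hx : x ∈ a)
    (hx' : x' ∈ a) : S.rbar x = S.rbar x' := by
  obtain ⟨b, hb, rfl⟩ := ha
  obtain ⟨y, hy, rfl⟩ := hx
  obtain ⟨y', hy', rfl⟩ := hx'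
  rw [rbar_proj, rbar_proj, S.r_const b hb y hy y' hy']

end Quotient

/-! ### Measurability -/

section Measurability

variable {M : Type*} [MeasurableSpace M] {S : InducingScheme M}

theorem measurable_proj : Measurable S.proj := measurable_quotient_mk''

theorem measurePreserving_proj (μ : Measure S.Y) : MeasurePreserving S.proj μ (S.muBar μ) :=
  measurable_proj.measurePreserving μ

theorem measurable_r : Measurable S.r := by
  refine measurable_to_countable fun y₀ => ?_
  have : S.r ⁻¹' {S.r y₀} = ⋃₀ {a ∈ S.parts | ∃ y ∈ a, S.r y = S.r y₀} := by
    ext y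
    constructor
    · intro hy
      obtain ⟨a, ⟨ha, hya⟩, -⟩ := S.parts_isPartition.2 y
      exact ⟨a, ⟨ha, y, hya, hy⟩, hya⟩
    · rintro ⟨a, ⟨ha, y', hy', he⟩, hya⟩
      exact (S.r_const a ha y hya y' hy').trans he
  rw [this]
  exact MeasurableSet.sUnion (S.parts_countable.mono fun a ha => ha.1)
    fun a ha => S.parts_measurableSet a ha.1

theorem measurable_iterate_f (n : ℕ) : Measurable fun y : S.Y => S.f^[n] (y : M) :=
  (S.measurable_f.iterate n).comp measurable_subtype_coe

theorem measurable_inducedObservable {v : M → ℝ} (hv : Measurable v) :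
    Measurable (S.inducedObservable v) := by
  have : Measurable fun q : ℕ × S.Y => ∑ l ∈ Finset.range q.1, v (S.f^[l] (q.2 : M)) :=
    measurable_from_prod_countable_right fun n =>
      Finset.measurable_fun_sum (Finset.range n) fun l _ => hv.comp (measurable_iterate_f l)
  exact this.comp (measurable_r.prodMk measurable_id)

end Measurability

section Borel

variable {M : Type*} [TopologicalSpace M] [PolishSpace M] [MeasurableSpace M] [BorelSpace M]
  {S : InducingScheme M}

/-- By the Lusin-Souslin theorem, `π` maps measurable subsets of `W^u` to measurable sets. -/
theorem measurable_leafPoint : Measurable S.leafPoint := by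
  have := S.measurableSet_Y.standardBorel
  have := S.stable_measurable
  intro s hs
  convert (S.unstable_measurableSet.inter hs).image_of_measurable_injOn measurable_proj
    (injOn_proj.mono inter_subset_left) using 1
  ext x
  constructor
  · intro hx
    exact ⟨S.leafPoint x, ⟨leafPoint_mem x, hx⟩, proj_leafPoint x⟩
  · rintro ⟨y, ⟨hy, hys⟩, rfl⟩
    rwa [mem_preimage, leafPoint_proj hy]

theorem measurable_rbar : Measurable S.rbar :=
  (measurable_of_countable fun n : ℕ => (n : ℝ)).comp (measurable_r.comp measurable_leafPoint)

theorem measurableEmbedding_domRestrict_Fbar (h : S.PreservesLeaves) {a : Set S.Ybar}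
    (ha : MeasurableSet a) (hT : Measurable (S.Fbar h)) (hinj : InjOn (S.Fbar h) a) :
    MeasurableEmbedding (a.domRestrict (S.Fbar h)) := by
  have := S.measurableSet_Y.standardBorel
  have := S.stable_measurable
  refine ⟨injOn_iff_injective.1 hinj, hT.comp measurable_subtype_coe, fun s hs => ?_⟩
  have hs' : MeasurableSet (S.proj ⁻¹' (Subtype.val '' s)) :=
    measurable_proj ((MeasurableEmbedding.subtype_coe ha).measurableSet_image.2 hs)
  convert (S.unstable_measurableSet.inter hs').image_of_measurable_injOn
    (hT.comp measurable_proj) ?_ using 1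
  · ext x
    constructor
    · rintro ⟨z, hz, rfl⟩
      exact ⟨S.leafPoint z, ⟨leafPoint_mem _, z, hz, (proj_leafPoint _).symm⟩,
        congrArg (S.Fbar h) (proj_leafPoint _)⟩
    · rintro ⟨y, ⟨-, z, hz, hzy⟩, rfl⟩
      exact ⟨z, hz, congrArg (S.Fbar h) hzy⟩
  · rintro y ⟨hy, z, -, hz⟩ y' ⟨hy', z', -, hz'⟩ he
    exact injOn_proj hy hy' (hinj (hz ▸ z.2) (hz' ▸ z'.2) he)

end Borel

/-! ### Integrals over the tower -/

section Tower

variable {M : Type*} [MeasurableSpace M] {S : InducingScheme M} {μ : Measure S.Y}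

theorem measurableSet_tower : MeasurableSet {q : S.Y × ℕ | q.2 < S.r q.1} :=
  measurableSet_lt measurable_snd (measurable_r.comp measurable_fst)

theorem measurable_tower_proj : Measurable fun q : S.Y × ℕ => S.f^[q.2] (q.1 : M) :=
  measurable_from_prod_countable_left measurable_iterate_f

theorem prodMk_preimage_tower (y : S.Y) :
    Prod.mk y ⁻¹' {q : S.Y × ℕ | q.2 < S.r q.1} = Finset.range (S.r y) := by
  ext l
  simp

theorem prod_count_tower :
    (μ.prod Measure.count) {q : S.Y × ℕ | q.2 < S.r q.1} = ∫⁻ y, (S.r y : ℝ≥0∞) ∂μ := by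
  rw [Measure.prod_apply measurableSet_tower]
  simp only [prodMk_preimage_tower, Measure.count_apply_finset, Finset.card_range]

theorem lintegral_r_ne_top (hr : Integrable (fun y => (S.r y : ℝ)) μ) :
    ∫⁻ y, (S.r y : ℝ≥0∞) ∂μ ≠ ∞ := by
  simpa using hr.lintegral_lt_top.ne

theorem lintegral_r_ne_zero [NeZero μ] : ∫⁻ y, (S.r y : ℝ≥0∞) ∂μ ≠ 0 := by
  refine ((Measure.measure_univ_pos.2 (NeZero.ne μ)).trans_le ?_).ne'
  rw [← lintegral_one]
  exact lintegral_mono fun y => Nat.one_le_cast.2 (S.r_pos y)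

theorem isFiniteMeasure_muM [NeZero μ] [SFinite μ] (hr : Integrable (fun y => (S.r y : ℝ)) μ) :
    IsFiniteMeasure (S.muM μ) := by
  have : IsFiniteMeasure (S.towerMeasure μ) := ⟨by
    rw [towerMeasure, Measure.smul_apply, Measure.restrict_apply_univ, prod_count_tower,
      smul_eq_mul, ENNReal.inv_mul_cancel lintegral_r_ne_zero (lintegral_r_ne_top hr)]
    exact ENNReal.one_lt_top⟩
  exact Measure.isFiniteMeasure_map _ _

variable {E : Type*} [NormedAddCommGroup E] [NormedSpace ℝ E]

theorem integral_count_tower [CompleteSpace E] (φ : ℕ → E) (n : ℕ) :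
    ∫ l, (Finset.range n : Set ℕ).indicator φ l ∂Measure.count = ∑ l ∈ Finset.range n, φ l := by
  rw [integral_indicator (Finset.measurableSet _), setIntegral_finset]
  · simp [measureReal_def]
  · rw [← biUnion_of_singleton (Finset.range n : Set ℕ)]
    exact integrableOn_finset_iUnion.2 fun _ _ =>
      integrableOn_singleton (hx := by simp)

theorem integral_muM [CompleteSpace E] [SFinite μ] (hr : Integrable (fun y => (S.r y : ℝ)) μ)
    {v : M → E} (hv : StronglyMeasurable v) {B : ℝ} (hB : ∀ x, ‖v x‖ ≤ B) :
    ∫ x, v x ∂(S.muM μ) =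
      (∫⁻ y, (S.r y : ℝ≥0∞) ∂μ)⁻¹.toReal • ∫ y, S.inducedObservable v y ∂μ := by
  have hfin : IsFiniteMeasure ((μ.prod Measure.count).restrict {q : S.Y × ℕ | q.2 < S.r q.1}) := by
    refine ⟨?_⟩
    rw [Measure.restrict_apply_univ, prod_count_tower]
    exact (lintegral_r_ne_top hr).lt_top
  have hint : IntegrableOn (fun q : S.Y × ℕ => v (S.f^[q.2] (q.1 : M)))
      {q : S.Y × ℕ | q.2 < S.r q.1} (μ.prod Measure.count) :=
    Integrable.of_bound (hv.comp_measurable measurable_tower_proj).aestronglyMeasurable B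
      (.of_forall fun q => hB _)
  rw [muM, integral_map measurable_tower_proj.aemeasurable hv.aestronglyMeasurable, towerMeasure,
    integral_smul_measure, ← integral_indicator measurableSet_tower,
    integral_prod _ ((integrable_indicator_iff measurableSet_tower).2 hint)]
  congr! 3 with y
  rw [inducedObservable, ← integral_count_tower, ← prodMk_preimage_tower]
  rfl

theorem integral_inducedObservable_eq_zero [CompleteSpace E] [NeZero μ] [SFinite μ]
    (hr : Integrable (fun y => (S.r y : ℝ)) μ) {v : M → E} (hv : StronglyMeasurable v) {B : ℝ}
    (hB : ∀ x, ‖v x‖ ≤ B) (hmean : ∫ x, v x ∂(S.muM μ) = 0) :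
    ∫ y, S.inducedObservable v y ∂μ = 0 := by
  rw [integral_muM hr hv hB] at hmean
  refine (smul_eq_zero.1 hmean).resolve_left ?_
  exact (ENNReal.toReal_pos (ENNReal.inv_ne_zero.2 (lintegral_r_ne_top hr))
    (ENNReal.inv_ne_top.2 lintegral_r_ne_zero)).ne'

end Tower

end InducingScheme

/-! ### Regular observables -/

section Holder

variable {M E : Type*} [MetricSpace M] [NormedAddCommGroup E] {v : M → E}

theorem norm_sub_le_of_dist_le_mul_pow {c η : ℝ≥0} (hv : HolderWith c η v) {C γ : ℝ} (hC : 0 ≤ C)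
    (hγ : 0 ≤ γ) {k : ℕ} {x x' : M} (h : dist x x' ≤ C * γ ^ k) :
    ‖v x - v x'‖ ≤ c * C ^ (η : ℝ) * (γ ^ (η : ℝ)) ^ k := by
  rw [← dist_eq_norm]
  refine (hv.dist_le_of_le h).trans_eq ?_
  rw [Real.mul_rpow hC (by positivity), ← Real.rpow_natCast, ← Real.rpow_natCast,
    ← Real.rpow_mul hγ, ← Real.rpow_mul hγ, mul_comm (k : ℝ), mul_assoc]

theorem IsHolderObservable.continuous (hv : IsHolderObservable v) : Continuous v := by
  obtain ⟨-, c, η, hη, -, hvη⟩ := hv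
  exact hvη.continuous hη

end Holder

namespace InducingScheme

section InducedObservable

variable {M E : Type*} [MeasurableSpace M] [NormedAddCommGroup E] {S : InducingScheme M}
  {v : M → E} {B : ℝ}

theorem norm_inducedObservable_le (hB : ∀ x, ‖v x‖ ≤ B) (y : S.Y) :
    ‖S.inducedObservable v y‖ ≤ B * S.r y := by
  rw [mul_comm, ← nsmul_eq_mul]
  simpa [inducedObservable] using
    norm_sum_le_of_le (Finset.range (S.r y)) fun l _ => hB (S.f^[l] (y : M))

theorem norm_inducedObservable_sub_le {y y' : S.Y} (hr : S.r y = S.r y')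
    (hB : ∀ l < S.r y, ‖v (S.f^[l] (y : M)) - v (S.f^[l] (y' : M))‖ ≤ B) :
    ‖S.inducedObservable v y - S.inducedObservable v y'‖ ≤ B * S.r y := by
  rw [inducedObservable, inducedObservable, ← hr, ← Finset.sum_sub_distrib]
  simpa [mul_comm] using norm_sum_le_of_le (Finset.range (S.r y)) fun l hl =>
    hB l (Finset.mem_range.1 hl)

end InducedObservable

/-- An observable on `Y` that, relative to the inducing time, is bounded, contracts exponentially
along stable leaves, and is dynamically Lipschitz along the orbits of the unstable leaf. -/
structure IsRegularObservable {M : Type*} [MeasurableSpace M] (S : InducingScheme M) (H γ : ℝ)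
    (V : S.Y → ℝ) : Prop where
  nonneg : 0 ≤ H
  rate_pos : 0 < γ
  rate_lt_one : γ < 1
  measurable : Measurable V
  abs_le : ∀ y, |V y| ≤ H * S.r y
  abs_sub_le_of_stable : ∀ y y', S.stable y y' → ∀ j,
    |V (S.F^[j] y) - V (S.F^[j] y')| ≤ H * γ ^ j * S.r (S.F^[j] y)
  abs_sub_le_of_unstable : ∀ y ∈ S.unstable, ∀ y' ∈ S.unstable, ∀ n : ℕ,
    separationTime S.F S.parts y y' = n → ∀ j < n,
      |V (S.F^[j] y) - V (S.F^[j] y')| ≤ H * γ ^ (n - j) * S.r (S.F^[j] y')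

theorem exists_isRegularObservable {M : Type*} [MeasurableSpace M] [MetricSpace M]
    [OpensMeasurableSpace M] {S : InducingScheme M} (hA1 : S.PreservesLeaves)
    (hA2 : S.IsUniformlyHyperbolic) {v : M → ℝ} (hv : IsHolderObservable v) :
    ∃ H γ, S.IsRegularObservable H γ (S.inducedObservable v) := by
  have hvm := measurable_inducedObservable (S := S) hv.continuous.measurable
  obtain ⟨C, γ, hC, hγ0, hγ1, hs, hu⟩ := hA2
  obtain ⟨⟨B, hB⟩, c, η, hη0, -, hvη⟩ := hv
  have hC0 : 0 ≤ C := zero_le_one.trans hC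
  have hcC : 0 ≤ c * C ^ (η : ℝ) := by positivity
  have hD : c * C ^ (η : ℝ) ≤ |B| + c * C ^ (η : ℝ) := le_add_of_nonneg_left (abs_nonneg B)
  have hsub {k : ℕ} {y y' : S.Y} (hr : S.r y = S.r y')
      (hd : ∀ l ≤ S.r y, dist (S.f^[l] (y : M)) (S.f^[l] (y' : M)) ≤ C * γ ^ k) :
      |S.inducedObservable v y - S.inducedObservable v y'| ≤
        (|B| + c * C ^ (η : ℝ)) * (γ ^ (η : ℝ)) ^ k * S.r y := by
    refine (norm_inducedObservable_sub_le hr fun l hl =>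
      norm_sub_le_of_dist_le_mul_pow hvη hC0 hγ0.le (hd l hl.le)).trans ?_
    gcongr
  refine ⟨|B| + c * C ^ (η : ℝ), γ ^ (η : ℝ), by positivity, by positivity,
    Real.rpow_lt_one hγ0.le hγ1 (NNReal.coe_pos.2 hη0), hvm, fun y => ?_, fun y y' hy j => ?_,
    fun y hy y' hy' n hn j hj => ?_⟩
  · refine norm_inducedObservable_le (v := v) (fun x => ?_) y
    exact ((hB x).trans (le_abs_self B)).trans (le_add_of_nonneg_right hcC)
  · exact hsub (r_eq_of_stable (stable_iterate hA1 hy j)) (hs y y' hy j)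
  · obtain ⟨a, ha, hya, hya'⟩ := natCast_le_separationTime.1 hn.ge j hj
    have hr := S.r_const a ha _ hya _ hya'
    rw [← hr]
    refine hsub hr fun l hl => (hu y hy y' hy' n hn j l hl).trans_eq ?_
    rw [← Nat.cast_sub hj.le, zpow_natCast]

/-! ### Observables on the quotient -/

section Quotient

variable {M : Type*} [MeasurableSpace M] (S : InducingScheme M)

/-- The observable `V ∘ F^j` evaluated at the unstable leaf, as a function on the quotient. -/
noncomputable def leafObservable (V : S.Y → ℝ) (j : ℕ) (x : S.Ybar) : ℝ :=
  V (S.F^[j] (S.leafPoint x))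

/-- The increments whose sum is the quotient observable: telescoping this sum along orbits turns
`V` into an observable that is constant on stable leaves, up to a coboundary. -/
noncomputable def leafIncrement (hA1 : S.PreservesLeaves) (V : S.Y → ℝ) : ℕ → S.Ybar → ℝ
  | 0 => S.leafObservable V 0
  | j + 1 => fun x => S.leafObservable V (j + 1) x - S.leafObservable V j (S.Fbar hA1 x)

variable {S}

theorem measurable_leafIncrement (hA1 : S.PreservesLeaves) (hT : Measurable (S.Fbar hA1))
    {V : S.Y → ℝ} (hV : ∀ j, Measurable (S.leafObservable V j)) :
    ∀ j, Measurable (S.leafIncrement hA1 V j)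
  | 0 => hV 0
  | j + 1 => (hV (j + 1)).sub ((hV j).comp hT)

namespace IsRegularObservable

variable {V : S.Y → ℝ} {H γ θ : ℝ} (hV : S.IsRegularObservable H γ V) (hA1 : S.PreservesLeaves)
include hV

theorem abs_leafIncrement_le (hγθ : γ ≤ θ) (j : ℕ) (x : S.Ybar) :
    |S.leafIncrement hA1 V j x| ≤ (H + H * θ⁻¹) * θ ^ j * S.rbar ((S.Fbar hA1)^[j] x) := by
  have hH := hV.nonneg
  have hγ := hV.rate_pos
  have hθ : 0 < θ := hγ.trans_le hγθ
  have hr := rbar_nonneg ((S.Fbar hA1)^[j] x)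
  rcases j with _ | j
  · calc |V (S.leafPoint x)| ≤ H * S.rbar x := hV.abs_le _
      _ ≤ (H + H * θ⁻¹) * θ ^ 0 * S.rbar x := by
          rw [pow_zero, mul_one]
          exact mul_le_mul_of_nonneg_right (le_add_of_nonneg_right (by positivity)) hr
  · have h1 := hV.abs_sub_le_of_stable _ _ (stable_F_leafPoint hA1 x) j
    rw [← Function.iterate_succ_apply, ← rbar_iterate_Fbar hA1] at h1
    calc _ ≤ H * γ ^ j * S.rbar ((S.Fbar hA1)^[j + 1] x) := h1
      _ ≤ H * θ ^ j * S.rbar ((S.Fbar hA1)^[j + 1] x) := by gcongr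
      _ = H * θ⁻¹ * θ ^ (j + 1) * S.rbar ((S.Fbar hA1)^[j + 1] x) := by
          rw [pow_succ']
          field_simp
      _ ≤ _ := by gcongr; exact le_add_of_nonneg_left hH

theorem abs_leafObservable_sub_le (hγθ : γ ≤ θ)
    (hsep : ∀ x y, x ≠ y → separationTime (S.Fbar hA1) S.alpha x y ≠ ⊤) {j : ℕ} {x y : S.Ybar}
    (hxy : (j : ℕ∞) < separationTime (S.Fbar hA1) S.alpha x y) :
    |S.leafObservable V j x - S.leafObservable V j y| ≤
      H * S.rbar ((S.Fbar hA1)^[j] y) * (θ⁻¹ ^ j * symbolicDist (S.Fbar hA1) S.alpha θ x y) := by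
  have hH := hV.nonneg
  have hγ := hV.rate_pos
  have hθ : 0 < θ := hγ.trans_le hγθ
  have hr := rbar_nonneg ((S.Fbar hA1)^[j] y)
  rcases eq_or_ne x y with rfl | hne
  · rw [sub_self, abs_zero]
    have := symbolicDist_nonneg (T := S.Fbar hA1) (P := S.alpha) hθ.le x x
    positivity
  obtain ⟨n, hn⟩ := ENat.ne_top_iff_exists.1 (hsep x y hne)
  have hjn : j < n := by rwa [← hn, Nat.cast_lt] at hxy
  have hn' : separationTime S.F S.parts (S.leafPoint x) (S.leafPoint y) = n := by
    rw [← separationTime_proj hA1, proj_leafPoint, proj_leafPoint, hn]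
  have hpow : θ⁻¹ ^ j * θ ^ n = θ ^ (n - j) := by
    rw [inv_pow, ← Nat.add_sub_of_le hjn.le, pow_add, inv_mul_cancel_left₀ (pow_pos hθ j).ne',
      Nat.add_sub_cancel_left]
  rw [symbolicDist_of_eq hn.symm, hpow, rbar_iterate_Fbar, mul_right_comm]
  refine (hV.abs_sub_le_of_unstable _ (leafPoint_mem x) _ (leafPoint_mem y) n hn' j hjn).trans ?_
  gcongr

theorem abs_leafIncrement_sub_le (hγθ : γ ≤ θ)
    (hsep : ∀ x y, x ≠ y → separationTime (S.Fbar hA1) S.alpha x y ≠ ⊤) {j : ℕ} {x y : S.Ybar}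
    (hxy : (j : ℕ∞) < separationTime (S.Fbar hA1) S.alpha x y) :
    |S.leafIncrement hA1 V j x - S.leafIncrement hA1 V j y| ≤
      2 * H * S.rbar ((S.Fbar hA1)^[j] y) *
        (θ⁻¹ ^ j * symbolicDist (S.Fbar hA1) S.alpha θ x y) := by
  have hθ : 0 < θ := hV.rate_pos.trans_le hγθ
  have h0 := hV.abs_leafObservable_sub_le hA1 hγθ hsep hxy
  set e := H * S.rbar ((S.Fbar hA1)^[j] y) *
    (θ⁻¹ ^ j * symbolicDist (S.Fbar hA1) S.alpha θ x y) with he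
  suffices |S.leafIncrement hA1 V j x - S.leafIncrement hA1 V j y| ≤ e + e by
    refine this.trans_eq ?_
    rw [he]
    ring
  rcases j with _ | j
  · exact h0.trans (le_add_of_nonneg_left ((abs_nonneg _).trans h0))
  have hP := separationTime_pos.1 ((Nat.cast_nonneg' (j + 1)).trans_lt hxy)
  rw [separationTime_eq_add_one hP, Nat.cast_add, Nat.cast_one,
    ENat.add_lt_add_iff_right ENat.one_ne_top] at hxy
  have h1 := hV.abs_leafObservable_sub_le hA1 hγθ hsep hxy
  have hd : θ⁻¹ ^ j * symbolicDist (S.Fbar hA1) S.alpha θ (S.Fbar hA1 x) (S.Fbar hA1 y) =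
      θ⁻¹ ^ (j + 1) * symbolicDist (S.Fbar hA1) S.alpha θ x y := by
    rw [symbolicDist_eq_mul (x := x) (y := y) hP, pow_succ, mul_assoc,
      inv_mul_cancel_left₀ hθ.ne']
  rw [hd, ← Function.iterate_succ_apply, ← he] at h1
  simp only [leafIncrement]
  rw [sub_sub_sub_comm]
  exact (abs_sub _ _).trans (add_le_add h0 h1)

theorem isControlled_leafIncrement (hγθ : γ ≤ θ)
    (hsep : ∀ x y, x ≠ y → separationTime (S.Fbar hA1) S.alpha x y ≠ ⊤)
    (hm : ∀ j, Measurable (S.leafIncrement hA1 V j)) (j : ℕ) :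
    IsControlled (S.Fbar hA1) S.alpha θ (2 * H + H * θ⁻¹) S.rbar j (S.leafIncrement hA1 V j) := by
  have hH := hV.nonneg
  have hθ : 0 < θ := hV.rate_pos.trans_le hγθ
  refine ⟨hm j, fun x => (hV.abs_leafIncrement_le hA1 hγθ j x).trans ?_,
    fun x y hxy => (hV.abs_leafIncrement_sub_le hA1 hγθ hsep hxy).trans ?_⟩
  · have hr := rbar_nonneg ((S.Fbar hA1)^[j] x)
    gcongr
    linarith
  · have hr := rbar_nonneg ((S.Fbar hA1)^[j] y)
    have hd := symbolicDist_nonneg (T := S.Fbar hA1) (P := S.alpha) hθ.le x y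
    gcongr
    exact le_add_of_nonneg_right (by positivity)

end IsRegularObservable

end Quotient

end InducingScheme

/-! ### The decomposition -/

theorem hasSum_of_eq_add_of_eq_sub {𝕜 E : Type*} [NontriviallyNormedField 𝕜]
    [NormedAddCommGroup E] [NormedSpace 𝕜 E] {κ : E →L[𝕜] E} {a w : ℕ → E} {v χ : E}
    (ha : HasSum a χ) (h0 : w 0 = v + a 0) (hw : ∀ j, w (j + 1) = a (j + 1) - κ (a j)) :
    HasSum w (v + χ - κ χ) := by
  have htail : HasSum (fun j => w (j + 1)) (χ - a 0 - κ χ) := by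
    simp only [hw]
    rw [← Finset.sum_range_one a]
    exact ((hasSum_nat_add_iff' 1).2 ha).sub (ha.mapL κ)
  convert htail.zero_add using 1
  rw [h0]
  abel

theorem IsControlled.summable_toLp {X : Type*} [MeasurableSpace X] {T : X → X} {μ : Measure X}
    {P : Set (Set X)} {θ B : ℝ} {r : X → ℝ} {p : ℝ≥0∞} [Fact (1 ≤ p)] {U : ℕ → X → ℝ}
    (hU : ∀ j, IsControlled T P θ B r j (U j)) (hT : MeasurePreserving T μ μ) (hθ : 0 ≤ θ)
    (hθ1 : θ < 1) (hB : 0 ≤ B) (hr : MemLp r p μ) :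
    Summable fun j => ((hU j).memLp hT hr).toLp (U j) :=
  .of_norm_bounded (((summable_geometric_of_lt_one hθ hθ1).mul_left B).mul_right _)
    fun j => (hU j).norm_toLp_le hT hθ hB hr

theorem IsGibbsMap.exists_eq_add_koopman_sub {X : Type*} [MeasurableSpace X] {T : X → X}
    {μ : Measure X} [IsProbabilityMeasure μ] {P : Set (Set X)} {θ K B : ℝ} {δ : ℝ≥0∞}
    {g : X → ℝ≥0∞} {r : X → ℝ} {p : ℝ≥0∞} [Fact (1 ≤ p)] (h : IsGibbsMap T μ P θ K δ g)
    (hmix : IsMixing T μ) (hB : 0 ≤ B) (hrm : Measurable r) (hr : MemLp r p μ)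
    (hr0 : ∀ x, 0 ≤ r x) (hrP : ∀ a ∈ P, ∀ x ∈ a, ∀ y ∈ a, r x = r y) {U : ℕ → X → ℝ}
    (hU : ∀ j, IsControlled T P θ B r j (U j)) {w : Lp ℝ p μ}
    (hw : HasSum (fun j => ((hU j).memLp h.measurePreserving hr).toLp (U j)) w)
    (hw0 : integralLp p μ w = 0) :
    ∃ m χ : Lp ℝ p μ, w = m + koopman h.measurePreserving χ - χ ∧
      transferLp h.measurePreserving m = 0 := by
  have hint : HasSum (fun j => ∫ x, U j x ∂μ) 0 := by
    simpa only [integralLp_toLp, hw0] using hw.mapL (integralLp p μ)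
  have hcentred : HasSum (fun j => ((hU j).memLp h.measurePreserving hr).toLp (U j) -
      Lp.const p μ (∫ x, U j x ∂μ)) w := by
    simpa using hw.sub (hint.mapL (Lp.constL p μ ℝ))
  obtain ⟨C, ν, -, hν, hν1, hbound⟩ := h.exists_norm_transferLp_pow_le hmix hB hrm hr hr0 hrP
  exact exists_eq_add_sub_of_summable_pow (transferLp_koopman h.measurePreserving)
    (summable_pow_apply_of_hasSum hν.le hν1 (fun j n => hbound j _ (hU j) n) hcentred)

namespace InducingScheme

section LeafDefect

variable {M : Type*} [MeasurableSpace M] (S : InducingScheme M)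

/-- The error made when `V ∘ F^j` is replaced by its value at the unstable leaf. -/
noncomputable def leafDefect (V : S.Y → ℝ) (j : ℕ) (y : S.Y) : ℝ :=
  S.leafObservable V j (S.proj y) - V (S.F^[j] y)

variable {S}

theorem leafIncrement_zero_proj (hA1 : S.PreservesLeaves) (V : S.Y → ℝ) (y : S.Y) :
    S.leafIncrement hA1 V 0 (S.proj y) = V y + S.leafDefect V 0 y :=
  (add_sub_cancel (V y) _).symm

theorem leafIncrement_succ_proj (hA1 : S.PreservesLeaves) (V : S.Y → ℝ) (j : ℕ) (y : S.Y) :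
    S.leafIncrement hA1 V (j + 1) (S.proj y) =
      S.leafDefect V (j + 1) y - S.leafDefect V j (S.F y) :=
  (sub_sub_sub_cancel_right _ _ (V (S.F^[j + 1] y))).symm

namespace IsRegularObservable

variable {V : S.Y → ℝ} {H γ : ℝ} (hV : S.IsRegularObservable H γ V) {μ : Measure S.Y}
  {p : ℝ≥0∞}
include hV

theorem memLp (hr : MemLp (fun y => (S.r y : ℝ)) p μ) : MemLp V p μ :=
  (hr.const_mul H).mono' hV.measurable.aestronglyMeasurable (.of_forall hV.abs_le)

variable (hA1 : S.PreservesLeaves)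
include hA1

theorem abs_leafDefect_le (j : ℕ) (y : S.Y) :
    |S.leafDefect V j y| ≤ H * γ ^ j * S.r (S.F^[j] y) := by
  have hy := stable_leafPoint_proj y
  rw [← r_eq_of_stable (stable_iterate hA1 hy j)]
  exact hV.abs_sub_le_of_stable _ _ hy j

theorem memLp_leafDefect (hF : MeasurePreserving S.F μ μ)
    (hr : MemLp (fun y => (S.r y : ℝ)) p μ) (hm : ∀ j, Measurable (S.leafObservable V j)) (j : ℕ) :
    MemLp (S.leafDefect V j) p μ :=
  ((hr.comp_measurePreserving (hF.iterate j)).const_mul (H * γ ^ j)).mono'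
    (((hm j).comp measurable_proj).sub
      (hV.measurable.comp (hF.measurable.iterate j))).aestronglyMeasurable
    (.of_forall (hV.abs_leafDefect_le hA1 j))

theorem norm_toLp_leafDefect_le [Fact (1 ≤ p)] (hF : MeasurePreserving S.F μ μ)
    (hr : MemLp (fun y => (S.r y : ℝ)) p μ) (hm : ∀ j, Measurable (S.leafObservable V j)) (j : ℕ) :
    ‖(hV.memLp_leafDefect hA1 hF hr hm j).toLp‖ ≤ H * γ ^ j * ‖hr.toLp‖ := by
  have hH := hV.nonneg
  have hγ := hV.rate_pos
  rw [← norm_koopman (hF.iterate j) hr.toLp, koopman_toLp]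
  refine Lp.norm_le_mul_norm_of_ae_le_mul ?_
  filter_upwards [(hV.memLp_leafDefect hA1 hF hr hm j).coeFn_toLp,
    (hr.comp_measurePreserving (hF.iterate j)).coeFn_toLp] with y hy hry
  rw [hy, hry, Real.norm_eq_abs]
  refine (hV.abs_leafDefect_le hA1 j y).trans ?_
  gcongr
  exact Real.le_norm_self _

end IsRegularObservable

end LeafDefect

section Decomposition

variable {M : Type*} [TopologicalSpace M] [PolishSpace M] [MeasurableSpace M] [BorelSpace M]
  {S : InducingScheme M} {μ : Measure S.Y}

theorem memLp_rbar {p : ℝ≥0∞} (hr : MemLp (fun y => (S.r y : ℝ)) p μ) :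
    MemLp S.rbar p (S.muBar μ) := by
  rw [muBar, memLp_map_measure_iff measurable_rbar.aestronglyMeasurable
    measurable_proj.aemeasurable]
  exact hr.congr_norm (measurable_rbar.comp measurable_proj).aestronglyMeasurable
    (.of_forall fun y => by rw [Function.comp_apply, rbar_proj])

instance isProbabilityMeasure_muBar [IsProbabilityMeasure μ] :
    IsProbabilityMeasure (S.muBar μ) :=
  Measure.isProbabilityMeasure_map measurable_proj.aemeasurable

theorem QuotientMixingGibbsMarkov.exists_isGibbsMap {hA1 : S.PreservesLeaves}
    (hA3 : S.QuotientMixingGibbsMarkov hA1 μ) {γ : ℝ} (hγ1 : γ < 1) :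
    ∃ θ K δ g, γ ≤ θ ∧ IsGibbsMap (S.Fbar hA1) (S.muBar μ) S.alpha θ K δ g :=
  hA3.1.exists_isGibbsMap (fun a ha => measurableEmbedding_domRestrict_Fbar hA1
    (hA3.1.measurableSet a ha) hA3.1.ergodic.measurable (hA3.1.injOn a ha)) hγ1

namespace IsRegularObservable

variable {V : S.Y → ℝ} {H γ : ℝ} (hV : S.IsRegularObservable H γ V)
include hV

theorem measurable_leafObservable (hF : Measurable S.F) (j : ℕ) :
    Measurable (S.leafObservable V j) :=
  hV.measurable.comp ((hF.iterate j).comp measurable_leafPoint)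

theorem hasSum_koopman_leafIncrement (hF : MeasurePreserving S.F μ μ) (hA1 : S.PreservesLeaves)
    {p : ℝ≥0∞} [Fact (1 ≤ p)] (hr : MemLp (fun y => (S.r y : ℝ)) p μ)
    (hW : ∀ j, MemLp (S.leafIncrement hA1 V j) p (S.muBar μ)) :
    ∃ χ, HasSum (fun j => koopman (measurePreserving_proj μ) (hW j).toLp)
      ((hV.memLp hr).toLp + χ - koopman hF χ) := by
  have hm := hV.measurable_leafObservable hF.measurable
  have ha := hV.memLp_leafDefect hA1 hF hr hm
  have hsum : Summable fun j => (ha j).toLp :=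
    .of_norm_bounded (((summable_geometric_of_lt_one hV.rate_pos.le hV.rate_lt_one).mul_left
      H).mul_right _) (hV.norm_toLp_leafDefect_le hA1 hF hr hm)
  refine ⟨_, hasSum_of_eq_add_of_eq_sub hsum.hasSum ?_ fun j => ?_⟩
  · rw [koopman_toLp, ← MemLp.toLp_add]
    congr 1
    ext y
    exact leafIncrement_zero_proj hA1 V y
  · rw [koopman_toLp, koopman_toLp, ← MemLp.toLp_sub]
    congr 1
    ext y
    exact leafIncrement_succ_proj hA1 V j y

theorem exists_toLp_eq_koopman_add_sub [IsProbabilityMeasure μ] (hF : MeasurePreserving S.F μ μ)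
    {hA1 : S.PreservesLeaves} (hA3 : S.QuotientMixingGibbsMarkov hA1 μ) {p : ℝ≥0∞}
    [Fact (1 ≤ p)] (hr : MemLp (fun y => (S.r y : ℝ)) p μ) (hmean : ∫ y, V y ∂μ = 0) :
    ∃ (m : Lp ℝ p (S.muBar μ)) (ξ : Lp ℝ p μ),
      (hV.memLp hr).toLp = koopman (measurePreserving_proj μ) m + koopman hF ξ - ξ ∧
      transferLp hA3.1.ergodic.toMeasurePreserving m = 0 := by
  have hπ := measurePreserving_proj μ
  have hT := hA3.1.ergodic.toMeasurePreserving
  obtain ⟨θ, K, δ, g, hγθ, hG⟩ := hA3.exists_isGibbsMap hV.rate_lt_one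
  have hU := hV.isControlled_leafIncrement hA1 hγθ hA3.1.separates (measurable_leafIncrement hA1
    hT.measurable (hV.measurable_leafObservable hF.measurable))
  obtain ⟨χ₁, hχ₁⟩ := hV.hasSum_koopman_leafIncrement hF hA1 hr
    fun j => (hU j).memLp hT (memLp_rbar hr)
  have hB : 0 ≤ 2 * H + H * θ⁻¹ := by
    have := hV.nonneg
    have := hG.theta_pos
    positivity
  obtain ⟨w, hw⟩ := IsControlled.summable_toLp hU hT hG.theta_pos.le hG.theta_lt_one hB
    (memLp_rbar hr)
  have hπw : koopman hπ w = (hV.memLp hr).toLp + χ₁ - koopman hF χ₁ :=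
    (hw.mapL (koopman hπ)).unique hχ₁
  have hw0 : integralLp p (S.muBar μ) w = 0 := by
    rw [← integralLp_koopman hπ, hπw, map_sub, map_add, integralLp_koopman, add_sub_cancel_right,
      integralLp_toLp, hmean]
  obtain ⟨m, χ, rfl, hLm⟩ := hG.exists_eq_add_koopman_sub hA3.2 hB measurable_rbar (memLp_rbar hr)
    rbar_nonneg (fun a ha x hx y hy => rbar_eq_of_mem_alpha ha hx hy) hU hw hw0
  have hcomm : koopman hπ (koopman hT χ) = koopman hF (koopman hπ χ) := by
    rw [koopman_koopman, koopman_koopman]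
    rfl
  rw [map_sub, map_add, hcomm] at hπw
  refine ⟨m, koopman hπ χ + χ₁, ?_, hLm⟩
  rw [map_add, ← sub_eq_zero, ← sub_eq_zero.2 hπw.symm]
  abel

theorem exists_decomposition [IsProbabilityMeasure μ] (hF : MeasurePreserving S.F μ μ)
    {hA1 : S.PreservesLeaves} (hA3 : S.QuotientMixingGibbsMarkov hA1 μ)
    {p : ℝ≥0∞} (hp : 1 ≤ p) (hr : MemLp (fun y => (S.r y : ℝ)) p μ) (hmean : ∫ y, V y ∂μ = 0) :
    ∃ (m : S.Ybar → ℝ) (χ : S.Y → ℝ), MemLp m p (S.muBar μ) ∧ MemLp χ p μ ∧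
      (∀ᵐ y ∂μ, V y = m (S.proj y) + χ (S.F y) - χ y) ∧
      transferOperator (S.Fbar hA1) (S.muBar μ) m =ᵐ[S.muBar μ] 0 := by
  have : Fact (1 ≤ p) := ⟨hp⟩
  have hπ := measurePreserving_proj μ
  obtain ⟨m, ξ, hdec, hLm⟩ := hV.exists_toLp_eq_koopman_add_sub hF hA3 hr hmean
  refine ⟨m, ξ, Lp.memLp m, Lp.memLp ξ, ?_, ?_⟩
  · have hV' := (hV.memLp hr).coeFn_toLp
    rw [hdec] at hV'
    filter_upwards [hV', Lp.coeFn_sub (koopman hπ m + koopman hF ξ) ξ,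
      Lp.coeFn_add (koopman hπ m) (koopman hF ξ), coeFn_koopman hπ m, coeFn_koopman hF ξ]
      with y e1 e2 e3 e4 e5
    rw [← e1, e2, Pi.sub_apply, e3, Pi.add_apply, e4, e5]
    rfl
  · refine (coeFn_transferLp hA3.1.ergodic.toMeasurePreserving m).symm.trans ?_
    rw [hLm]
    exact Lp.coeFn_zero ℝ p _

end IsRegularObservable

end Decomposition

theorem inducedObservable_apply {M : Type*} [MeasurableSpace M] {S : InducingScheme M} {d : ℕ}
    (v : M → EuclideanSpace ℝ (Fin d)) (y : S.Y) (i : Fin d) :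
    S.inducedObservable v y i = S.inducedObservable (fun x => v x i) y := by
  simp [inducedObservable]

theorem integral_inducedObservable_apply_eq_zero {M : Type*} [MeasurableSpace M]
    {S : InducingScheme M} {μ : Measure S.Y} [NeZero μ] [SFinite μ]
    (hr : Integrable (fun y => (S.r y : ℝ)) μ) {d : ℕ} {v : M → EuclideanSpace ℝ (Fin d)}
    (hv : StronglyMeasurable v) {B : ℝ} (hB : ∀ x, ‖v x‖ ≤ B) (hmean : ∫ x, v x ∂(S.muM μ) = 0)
    (i : Fin d) : ∫ y, S.inducedObservable (fun x => v x i) y ∂μ = 0 := by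
  have := isFiniteMeasure_muM hr
  have hint := Integrable.of_bound hv.aestronglyMeasurable B (.of_forall hB) (μ := S.muM μ)
  refine integral_inducedObservable_eq_zero hr
    ((EuclideanSpace.proj (𝕜 := ℝ) i).continuous.comp_stronglyMeasurable hv)
    (fun x => (PiLp.norm_apply_le (v x) i).trans (hB x)) ?_
  exact ((EuclideanSpace.proj (𝕜 := ℝ) i).integral_comp_comm hint).trans (by rw [hmean, map_zero])

end InducingScheme

theorem IsHolderObservable.eval {M : Type*} [MetricSpace M] {d : ℕ}
    {v : M → EuclideanSpace ℝ (Fin d)} (hv : IsHolderObservable v) (i : Fin d) :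
    IsHolderObservable fun x => v x i := by
  obtain ⟨⟨B, hB⟩, C, η, hη0, hη1, hC⟩ := hv
  refine ⟨⟨B, fun x => (PiLp.norm_apply_le (v x) i).trans (hB x)⟩, C, η, hη0, hη1, fun x y => ?_⟩
  refine le_trans ?_ (hC x y)
  rw [edist_eq_enorm_sub, edist_eq_enorm_sub]
  exact enorm_le_iff_norm_le.2 (PiLp.norm_apply_le (v x - v y) i)

theorem mainTheorem1_general {M : Type*} [MetricSpace M] [PolishSpace M] [MeasurableSpace M]
    [BorelSpace M] (S : InducingScheme M) (μ : Measure S.Y) [IsProbabilityMeasure μ]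
    (hF : MeasurePreserving S.F μ μ) (hA1 : S.PreservesLeaves) (hA2 : S.IsUniformlyHyperbolic)
    (hA3 : S.QuotientMixingGibbsMarkov hA1 μ) {d : ℕ} (v : M → EuclideanSpace ℝ (Fin d))
    (hv : IsHolderObservable v) (hv_mean : ∫ x, v x ∂(S.muM μ) = 0) (p : ℝ≥0∞) (hp : 1 ≤ p)
    (hr : MemLp (fun y => (S.r y : ℝ)) p μ) :
    ∃ (m : S.Ybar → EuclideanSpace ℝ (Fin d)) (χ : S.Y → EuclideanSpace ℝ (Fin d)),
      MemLp m p (S.muBar μ) ∧ MemLp χ p μ ∧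
      (∀ᵐ y ∂μ, S.inducedObservable v y = m (S.proj y) + χ (S.F y) - χ y) ∧
      vectorTransferOperator (S.Fbar hA1) (S.muBar μ) m =ᵐ[S.muBar μ] 0 := by
  obtain ⟨B, hB⟩ := hv.1
  have hmean := S.integral_inducedObservable_apply_eq_zero (hr.integrable hp)
    hv.continuous.stronglyMeasurable hB hv_mean
  choose H γ hV using fun i => InducingScheme.exists_isRegularObservable hA1 hA2 (hv.eval i)
  choose m χ hm hχ hdec hker using fun i => (hV i).exists_decomposition hF hA3 hp hr (hmean i)
  refine ⟨fun x => WithLp.toLp 2 fun i => m i x, fun y => WithLp.toLp 2 fun i => χ i y,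
    MemLp.of_eval_piLp hm, MemLp.of_eval_piLp hχ, ?_, ?_⟩
  · filter_upwards [ae_all_iff.2 hdec] with y hy
    ext i
    exact (InducingScheme.inducedObservable_apply v y i).trans (hy i)
  · filter_upwards [ae_all_iff.2 hker] with x hx
    ext i
    exact hx i

theorem mainTheorem1 {M : Type*} [MetricSpace M] [PolishSpace M] [MeasurableSpace M] [BorelSpace M]
    (S : InducingScheme M)
    (μ : Measure S.Y) [IsProbabilityMeasure μ] (hμ : Ergodic S.F μ)
    (hA1 : S.PreservesLeaves)
    (hA2 : S.IsUniformlyHyperbolic)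
    (hA3 : S.QuotientMixingGibbsMarkov hA1 μ)
    (hA4 : Integrable (fun y => (S.r y : ℝ)) μ)
    {d : ℕ} (v : M → EuclideanSpace ℝ (Fin d)) (hv : IsHolderObservable v)
    (hv_mean : ∫ x, v x ∂(S.muM μ) = 0)
    (p : ℝ≥0∞) (hp : 1 ≤ p) (hp_top : p ≠ ∞)
    (hr : MemLp (fun y => (S.r y : ℝ)) p μ) :
    ∃ (m : S.Ybar → EuclideanSpace ℝ (Fin d)) (χ : S.Y → EuclideanSpace ℝ (Fin d)),
      MemLp m p (S.muBar μ) ∧ MemLp χ p μ ∧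
      (∀ᵐ y ∂μ, S.inducedObservable v y = m (S.proj y) + χ (S.F y) - χ y) ∧
      vectorTransferOperator (S.Fbar hA1) (S.muBar μ) m =ᵐ[S.muBar μ] 0 :=
  mainTheorem1_general S μ hμ.toMeasurePreserving hA1 hA2 hA3 v hv hv_mean p hp hr
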